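/- Let $p,q\ge 0$ be integers, $n=p+q\ge 1$. Let $C\ell_{p,q}$ be the real Clifford algebra with identity $e$ and generators $e^1,\dots,e^n$ satisfying $e^ae^b+e^be^a=2\eta^{ab}e$, where $\eta=\mathrm{diag}(1,\dots,1,-1,\dots,-1)$ has $p$ entries $+1$ and $q$ entries $-1$. Let $C\ell^{(0)}_{p,q}$ and $C\ell^{(1)}_{p,q}$ be its even and odd parts. On $C\ell_{p,q}$ and on $\mathbb C\otimes C\ell_{p,q}$ let $U\mapsto\hat U$ be the grade involution (the automorphism with $e^a\mapsto -e^a$), $U\mapsto\tilde U$ the reversion (the linear anti-automorphism with $e^a\mapsto e^a$), and $U^\ddagger=\tilde{\bar U}$, where $\bar U$ conjugates the complex coefficients in the basis of products of generators. Put $$G^{23}_{p,q}=\{U\in C\ell_{p,q}:\tilde UU=e\},\qquad G^{12}_{p,q}=\{U\in C\ell_{p,q}:\tilde{\hat U}U=e\},\qquad G^{2}_{p,q}=\{U\in C\ell^{(0)}_{p,q}:\tilde UU=e\},$$ $$G^{2i1}_{p,q}=\{U\in C\ell^{(0)}_{p,q}\oplus iC\ell^{(1)}_{p,q}:U^\ddagger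 U=e\},\qquad G^{2i3}_{p,q}=\{U\in C\ell^{(0)}_{p,q}\oplus iC\ell^{(1)}_{p,q}:\hat U^\ddagger U=e\}.$$ Also put $U(r)=\{A\in \mathrm{Mat}(r,\mathbb C):A^\dagger A=1\}$, $U(r,s)=\{A\in \mathrm{Mat}(r+s,\mathbb C):A^\dagger\eta_{r,s}A=\eta_{r,s}\}$ with $\eta_{r,s}=\mathrm{diag}(1_r,-1_s)$, $\mathrm{Sp}(r,\mathbb C)=\{A\in \mathrm{Mat}(2r,\mathbb C):A^T\Omega A=\Omega\}$ with $\Omega=\begin{pmatrix}0&-1\\1&0\end{pmatrix}$ (blocks of size $r$), and $O(r,\mathbb C)=\{A\in \mathrm{Mat}(r,\mathbb C):A^TA=1\}$. Then the following isomorphisms of Lie groups hold. (1) If $p-q\equiv 3,7 \pmod 8$ (so $n$ is odd), then $$G^{23}_{p,q}\simeq\begin{cases}U(2^{\frac{n-1}2}),&(p,q)=(n,0);\\ U(2^{\frac{n-3}2},2^{\frac{n-3}2}),&n\equiv 3,7 \pmod 8,\ q\ne0;\\ \mathrm{Sp}(2^{\frac{n-3}2},\mathbb C),&n\equiv5 \pmod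 8;\\ O(2^{\frac{n-1}2},\mathbb C),&n\equiv1 \pmod 8.\end{cases}$$ (2) If $p-q\equiv 3,7 \pmod 8$ (so $n$ is odd), then $$G^{12}_{p,q}\simeq\begin{cases}U(2^{\frac{n-1}2}),&(p,q)=(0,n);\\ U(2^{\frac{n-3}2},2^{\frac{n-3}2}),&n\equiv 1,5 \pmod 8,\ p\ne0;\\ \mathrm{Sp}(2^{\frac{n-3}2},\mathbb C),&n\equiv3 \pmod 8;\\ O(2^{\frac{n-1}2},\mathbb C),&n\equiv7 \pmod 8.\end{cases}$$ (3) If $p-q\equiv 1,5 \pmod 8$ (so $n$ is odd), then $$G^{2i1}_{p,q}\simeq\begin{cases}U(2^{\frac{n-1}2}),&(p,q)=(n,0);\\ U(2^{\frac{n-3}2},2^{\frac{n-3}2}),&n\equiv 1,5 \pmod 8,\ q\ne0;\\ \mathrm{Sp}(2^{\frac{n-3}2},\mathbb C),&n\equiv3 \pmod 8;\\ O(2^{\frac{n-1}2},\mathbb C),&n\equiv7 \pmod 8.\end{cases}$$ (4) If $p-q\equiv 1,5 \pmod 8$ (so $n$ is odd), then $$G^{2i3}_{p,q}\simeq\begin{cases}U(2^{\frac{n-1}2}),&(p,q)=(0,n);\\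 U(2^{\frac{n-3}2},2^{\frac{n-3}2}),&n\equiv 3,7 \pmod 8,\ p\ne0;\\ \mathrm{Sp}(2^{\frac{n-3}2},\mathbb C),&n\equiv5 \pmod 8;\\ O(2^{\frac{n-1}2},\mathbb C),&n\equiv1 \pmod 8.\end{cases}$$ (5) If $p-q\equiv 2,6 \pmod 8$ (so $n$ is even), then $$G^{2}_{p,q}\simeq\begin{cases}U(2^{\frac{n-2}2}),&(p,q)=(n,0)\text{ or }(0,n);\\ U(2^{\frac{n-4}2},2^{\frac{n-4}2}),&n\equiv 2,6 \pmod 8,\ p\ne0,\ q\neq 0;\\ \mathrm{Sp}(2^{\frac{n-4}2},\mathbb C),&n\equiv4 \pmod 8;\\ O(2^{\frac{n-2}2},\mathbb C),&n\equiv0 \pmod 8.\end{cases}$$ -/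

import Mathlib

open scoped TensorProduct Matrix ContDiff

namespace CliffordGroups

noncomputable section

/-- The quadratic form of signature `(p, q)` on `ℝ^(p+q)`:
`x ↦ x₁² + ⋯ + x_p² - x_{p+1}² - ⋯ - x_{p+q}²`. -/
def form (p q : ℕ) : QuadraticForm ℝ (Fin p ⊕ Fin q → ℝ) :=
  QuadraticMap.weightedSumSquares ℝ
    (Sum.elim (fun _ => (1 : ℝ)) (fun _ => (-1 : ℝ)) : Fin p ⊕ Fin q → ℝ)

/-- The real Clifford algebra `Cl_{p,q}`: `p` generators square to `1` and `q` square to `-1`. -/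
abbrev Cl (p q : ℕ) : Type := CliffordAlgebra (form p q)

/-- The complexified Clifford algebra `ℂ ⊗ Cl_{p,q}`. -/
abbrev CCl (p q : ℕ) : Type := ℂ ⊗[ℝ] Cl p q

variable {p q : ℕ}

/-- Pseudo-Hermitian conjugation `U ↦ U‡` of the complexified Clifford algebra:
reversion composed with complex conjugation of the coefficients. -/
def pseudoHerm : CCl p q →ₗ[ℝ] CCl p q :=
  TensorProduct.map Complex.conjAe.toLinearMap CliffordAlgebra.reverse

/-- The grade involution of the complexified Clifford algebra. -/
def gradeInv : CCl p q →ₐ[ℝ] CCl p q :=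
  Algebra.TensorProduct.map (AlgHom.id ℝ ℂ) CliffordAlgebra.involute

theorem pseudoHerm_mul (U V : CCl p q) :
    pseudoHerm (U * V) = pseudoHerm V * pseudoHerm U := by
  induction U using TensorProduct.induction_on with
  | zero => simp
  | add a b ha hb => rw [add_mul, map_add, map_add, ha, hb, mul_add]
  | tmul z a =>
    induction V using TensorProduct.induction_on with
    | zero => simp
    | add c d hc hd => rw [mul_add, map_add, map_add, hc, hd, add_mul]
    | tmul w b =>
      simp [pseudoHerm, Algebra.TensorProduct.tmul_mul_tmul, mul_comm]

theorem pseudoHerm_one : pseudoHerm (1 : CCl p q) = 1 := by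
  simp [pseudoHerm, Algebra.TensorProduct.one_def]

/-- The real subspace `Cl^{(0)}_{p,q} ⊕ i Cl^{(1)}_{p,q}` of the complexified Clifford algebra. -/
def evenIOdd (p q : ℕ) : Submodule ℝ (CCl p q) :=
  (CliffordAlgebra.evenOdd (form p q) 0).map (TensorProduct.mk ℝ ℂ (Cl p q) 1) ⊔
    (CliffordAlgebra.evenOdd (form p q) 1).map (TensorProduct.mk ℝ ℂ (Cl p q) Complex.I)

theorem mem_evenIOdd {U : CCl p q} :
    U ∈ evenIOdd p q ↔
      ∃ a ∈ CliffordAlgebra.evenOdd (form p q) 0, ∃ b ∈ CliffordAlgebra.evenOdd (form p q) 1,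
        (1 : ℂ) ⊗ₜ[ℝ] a + Complex.I ⊗ₜ[ℝ] b = U := by
  simp [evenIOdd, Submodule.mem_sup]

theorem evenOdd_mul {i j k : ZMod 2} (h : i + j = k) {a b : Cl p q}
    (ha : a ∈ CliffordAlgebra.evenOdd (form p q) i)
    (hb : b ∈ CliffordAlgebra.evenOdd (form p q) j) :
    a * b ∈ CliffordAlgebra.evenOdd (form p q) k := by
  rw [← h]
  exact CliffordAlgebra.evenOdd_mul_le (form p q) i j (Submodule.mul_mem_mul ha hb)

theorem one_mem_even : (1 : Cl p q) ∈ CliffordAlgebra.evenOdd (form p q) 0 :=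
  CliffordAlgebra.one_le_evenOdd_zero (form p q) (Submodule.one_le.1 le_rfl)

theorem evenIOdd_one : (1 : CCl p q) ∈ evenIOdd p q :=
  mem_evenIOdd.2 ⟨1, one_mem_even, 0, zero_mem _, by simp [Algebra.TensorProduct.one_def]⟩

theorem evenIOdd_mul {U V : CCl p q} (hU : U ∈ evenIOdd p q) (hV : V ∈ evenIOdd p q) :
    U * V ∈ evenIOdd p q := by
  obtain ⟨a, ha, b, hb, rfl⟩ := mem_evenIOdd.1 hU
  obtain ⟨c, hc, d, hd, rfl⟩ := mem_evenIOdd.1 hV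
  refine mem_evenIOdd.2 ⟨a * c - b * d,
    sub_mem (evenOdd_mul (by decide) ha hc) (evenOdd_mul (by decide) hb hd),
    a * d + b * c,
    add_mem (evenOdd_mul (by decide) ha hd) (evenOdd_mul (by decide) hb hc), ?_⟩
  simp only [add_mul, mul_add, Algebra.TensorProduct.tmul_mul_tmul, one_mul, mul_one,
    Complex.I_mul_I, TensorProduct.neg_tmul, TensorProduct.tmul_sub, TensorProduct.tmul_add]
  abel

/-- `G^{23}_{p,q} = {U ∈ Cl_{p,q} : Ũ U = e}`. -/
def G23 (p q : ℕ) : Submonoid (Cl p q) where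
  carrier := {U | CliffordAlgebra.reverse U * U = 1}
  mul_mem' {a b} ha hb := by
    change CliffordAlgebra.reverse (a * b) * (a * b) = 1
    rw [CliffordAlgebra.reverse.map_mul, mul_assoc, ← mul_assoc _ a b,
      show CliffordAlgebra.reverse a * a = 1 from ha, one_mul]
    exact hb
  one_mem' := by simp

/-- `G^{12}_{p,q}`: the `U ∈ Cl_{p,q}` for which the reversion of the grade involution of `U`,
times `U`, is `e`. -/
def G12 (p q : ℕ) : Submonoid (Cl p q) where
  carrier := {U | CliffordAlgebra.reverse (CliffordAlgebra.involute U) * U = 1}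
  mul_mem' {a b} ha hb := by
    change CliffordAlgebra.reverse (CliffordAlgebra.involute (a * b)) * (a * b) = 1
    rw [map_mul, CliffordAlgebra.reverse.map_mul, mul_assoc, ← mul_assoc _ a b,
      show CliffordAlgebra.reverse (CliffordAlgebra.involute a) * a = 1 from ha, one_mul]
    exact hb
  one_mem' := by simp

/-- `G^{2}_{p,q} = {U ∈ Cl^{(0)}_{p,q} : Ũ U = e}`. -/
def G2 (p q : ℕ) : Submonoid (Cl p q) where
  carrier := {U | U ∈ CliffordAlgebra.evenOdd (form p q) 0 ∧ CliffordAlgebra.reverse U * U = 1}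
  mul_mem' {a b} ha hb :=
    ⟨evenOdd_mul (by decide) ha.1 hb.1, (G23 p q).mul_mem (x := a) (y := b) ha.2 hb.2⟩
  one_mem' := ⟨one_mem_even, (G23 p q).one_mem⟩

/-- `G^{2i1}_{p,q} = {U ∈ Cl^{(0)}_{p,q} ⊕ i Cl^{(1)}_{p,q} : U‡ U = e}`. -/
def G2i1 (p q : ℕ) : Submonoid (CCl p q) where
  carrier := {U | U ∈ evenIOdd p q ∧ pseudoHerm U * U = 1}
  mul_mem' {a b} ha hb := by
    refine ⟨evenIOdd_mul ha.1 hb.1, ?_⟩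
    rw [pseudoHerm_mul, mul_assoc, ← mul_assoc _ a b, ha.2, one_mul]
    exact hb.2
  one_mem' := ⟨evenIOdd_one, by rw [pseudoHerm_one, one_mul]⟩

/-- `G^{2i3}_{p,q} = {U ∈ Cl^{(0)}_{p,q} ⊕ i Cl^{(1)}_{p,q} : Û‡ U = e}`. -/
def G2i3 (p q : ℕ) : Submonoid (CCl p q) where
  carrier := {U | U ∈ evenIOdd p q ∧ pseudoHerm (gradeInv U) * U = 1}
  mul_mem' {a b} ha hb := by
    refine ⟨evenIOdd_mul ha.1 hb.1, ?_⟩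
    rw [map_mul, pseudoHerm_mul, mul_assoc, ← mul_assoc _ a b, ha.2, one_mul]
    exact hb.2
  one_mem' := ⟨evenIOdd_one, by rw [map_one, pseudoHerm_one, one_mul]⟩

/-- `U(r) = {A ∈ Mat(r, ℂ) : A† A = 1}`. -/
abbrev unitaryGrp (r : ℕ) : Submonoid (Matrix (Fin r) (Fin r) ℂ) :=
  Matrix.unitaryGroup (Fin r) ℂ

/-- `U(r, s) = {A ∈ Mat(r + s, ℂ) : A† η A = η}`, where `η = diag(1, …, 1, -1, …, -1)` has `r`
entries `1` and `s` entries `-1`. -/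
def pseudoUnitaryGrp (r s : ℕ) : Submonoid (Matrix (Fin r ⊕ Fin s) (Fin r ⊕ Fin s) ℂ) where
  carrier := {A | Aᴴ * Matrix.fromBlocks 1 0 0 (-1) * A = Matrix.fromBlocks 1 0 0 (-1)}
  mul_mem' {a b} ha hb := by
    simp only [Set.mem_ofPred_eq, Matrix.conjTranspose_mul] at *
    calc bᴴ * aᴴ * Matrix.fromBlocks 1 0 0 (-1) * (a * b)
        = bᴴ * (aᴴ * Matrix.fromBlocks 1 0 0 (-1) * a) * b := by simp only [Matrix.mul_assoc]
      _ = Matrix.fromBlocks 1 0 0 (-1) := by rw [ha, hb]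
  one_mem' := by simp

/-- `Sp(r, ℂ) = {A ∈ Mat(2r, ℂ) : Aᵀ Ω A = Ω}`. -/
abbrev complexSymplecticGrp (r : ℕ) : Submonoid (Matrix (Fin r ⊕ Fin r) (Fin r ⊕ Fin r) ℂ) :=
  Matrix.symplecticGroup (Fin r) ℂ

/-- `O(r, ℂ) = {A ∈ Mat(r, ℂ) : Aᵀ A = 1}`; the transpose is not conjugated. -/
abbrev complexOrthogonalGrp (r : ℕ) : Submonoid (Matrix (Fin r) (Fin r) ℂ) :=
  Matrix.orthogonalGroup (Fin r) ℂ

/-- A map `f : S → W` from a subset `S` of a finite-dimensional real vector space `V` to another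
such space `W` is smooth if near every point of `S` it is the restriction of a `C^∞` map between
open subsets of the ambient spaces, read in linear coordinates (the choice of these coordinates is
immaterial). On an embedded submanifold `S` this is the usual notion of smoothness. -/
def IsSmoothMap {V W : Type*} [AddCommGroup V] [Module ℝ V] [AddCommGroup W] [Module ℝ W]
    (S : Set V) (f : S → W) : Prop :=
  ∃ (d e : ℕ) (a : V ≃ₗ[ℝ] (Fin d → ℝ)) (b : W ≃ₗ[ℝ] (Fin e → ℝ)),
    ∀ x : S, ∃ (O : Set (Fin d → ℝ)) (F : (Fin d → ℝ) → (Fin e → ℝ)),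
      IsOpen O ∧ a x ∈ O ∧ ContDiffOn ℝ ∞ F O ∧ ∀ y : S, a y ∈ O → b (f y) = F (a y)

/-- Isomorphism of Lie groups, for groups `G` and `H` that are given as closed multiplicative
subsets of finite-dimensional real algebras and carry the smooth structure of the ambient spaces:
a group isomorphism that is smooth in both directions. (A multiplicative bijection of monoids, one
of which is a group, is an isomorphism of groups.) -/
def LieGroupIsomorphic {A B : Type*} [Ring A] [Algebra ℝ A] [Ring B] [Algebra ℝ B]
    (G : Submonoid A) (H : Submonoid B) : Prop :=
  ∃ φ : G ≃* H,
    IsSmoothMap (G : Set A) (fun x => ((φ x : H) : B)) ∧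
      IsSmoothMap (H : Set B) (fun y => ((φ.symm y : G) : A))

end

end CliffordGroups

open CliffordGroups

/-! Let `n = 2m+1`. The product of all generators is central with square `(-1)^(m+q)`, and for odd
`n` the condition `p - q ≡ 3 (mod 4)` says that this is `-1`. The product then acts as `±i`, and
`Cl_{p,q}` is the full algebra of complex matrices of size `2^m` (`GammaSystem.exists_algEquiv`);
each generator becomes `1` or `i` times a Hermitian involution `F a`.

Reversion, alone or after the grade involution, is an anti-automorphism `τ` that scales the
generators by a sign `σ`, hence the central product by `σ(-1)^m`. So it is complex linear, a
transpose adjoint, if `σ = (-1)^m`, and a Hermitian adjoint otherwise; `τ x * x = 1` says that the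
matrix of `x` preserves a form `S` (`IsScaledReversion.mul_eq_one_iff`). In the transpose case `S`
is symmetric for `m ≡ 0, 3 (mod 4)` and alternating for `m ≡ 1, 2` (`exists_gammaSystem`), which
gives the orthogonal and symplectic groups. In the Hermitian case `S` is, up to a phase, the product
of those `F a` whose weight is `-σ`. If there are none, `S = 1`; otherwise `S` anticommutes with one
of them and has split signature (`exists_congruent_balanced`).

The remaining families reduce to these two: the elements `i e^a` make `Cl^{(0)} ⊕ i Cl^{(1)}` a copy
of `Cl_{q,p}` (`exists_evenIOdd_model`), and the products `e^c e^a` with `c` fixed make the even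
part a Clifford algebra on one generator less (`exists_even_model`). All isomorphisms are
restrictions of linear maps, hence smooth. -/

namespace CliffordGroups

open CliffordAlgebra

/-! ### Clifford algebras of diagonal forms -/

section Orthogonal

variable {κ A : Type*} [Ring A] [Algebra ℝ A]

/-- The generator of the Clifford algebra of a diagonal form that belongs to a coordinate. -/
noncomputable def gen [Fintype κ] [DecidableEq κ] (w : κ → ℝ) (a : κ) :
    CliffordAlgebra (QuadraticMap.weightedSumSquares ℝ w) :=
  ι _ (Pi.single a 1)

theorem ι_eq_sum_gen [Fintype κ] [DecidableEq κ] (w : κ → ℝ) (v : κ → ℝ) :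
    ι (QuadraticMap.weightedSumSquares ℝ w) v = ∑ a, v a • gen w a := by
  conv_lhs => rw [← Finset.univ_sum_single v]
  rw [map_sum]
  refine Finset.sum_congr rfl fun a _ => ?_
  rw [gen, ← map_smul]
  congr 1
  ext b
  simp [Pi.single_apply]

theorem gen_sq [Fintype κ] [DecidableEq κ] (w : κ → ℝ) (a : κ) : gen w a * gen w a = algebraMap ℝ _ (w a) := by
  rw [gen, ι_sq_scalar]
  congr 1
  simp [QuadraticMap.weightedSumSquares_apply, Pi.single_apply]

theorem gen_anticomm [Fintype κ] [DecidableEq κ] (w : κ → ℝ) {a b : κ} (h : a ≠ b) :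
    gen w a * gen w b = -(gen w b * gen w a) := by
  rw [eq_neg_iff_add_eq_zero, gen, gen, ι_mul_ι_add_swap, QuadraticMap.polar]
  simp only [QuadraticMap.weightedSumSquares_apply, Pi.add_apply]
  rw [← Finset.sum_sub_distrib, ← Finset.sum_sub_distrib, Finset.sum_eq_zero, map_zero]
  intro c _
  by_cases h1 : c = a
  · subst h1; simp [h]
  · simp [Pi.single_apply, h1]

theorem adjoin_range_gen [Fintype κ] [DecidableEq κ] (w : κ → ℝ) : Algebra.adjoin ℝ (Set.range (gen w)) = ⊤ := by
  rw [← top_le_iff, ← adjoin_range_ι]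
  refine Algebra.adjoin_le ?_
  rintro _ ⟨v, rfl⟩
  rw [SetLike.mem_coe, ι_eq_sum_gen]
  exact sum_mem fun a _ => Subalgebra.smul_mem _ (Algebra.subset_adjoin (Set.mem_range_self a)) _

/-- An algebra homomorphism out of the Clifford algebra of a diagonal form is given by
anticommuting elements with the prescribed squares. -/
theorem exists_algHom_gen [Fintype κ] [DecidableEq κ] {w : κ → ℝ} {E : κ → A} (hsq : ∀ a, E a * E a = algebraMap ℝ A (w a))
    (hanti : ∀ a b, a ≠ b → E a * E b = -(E b * E a)) :
    ∃ f : CliffordAlgebra (QuadraticMap.weightedSumSquares ℝ w) →ₐ[ℝ] A, ∀ a, f (gen w a) = E a := by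
  let l : (κ → ℝ) →ₗ[ℝ] A := Fintype.linearCombination ℝ E
  have hl : ∀ v, l v * l v = algebraMap ℝ A (QuadraticMap.weightedSumSquares ℝ w v) := by
    intro v
    have h1 : l v * l v = ∑ a, ∑ b, (v a * v b) • (E a * E b) := by
      simp only [l, Fintype.linearCombination_apply, Finset.sum_mul_sum, smul_mul_smul_comm]
    have h2 : l v * l v = ∑ a, ∑ b, (v a * v b) • (E b * E a) := by
      rw [h1, Finset.sum_comm]
      simp only [mul_comm]
    -- Adding the double sum to its transpose cancels the off-diagonal terms by anticommutation and
    -- doubles the diagonal.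
    have h3 : (2 : ℝ) • (l v * l v) =
        (2 : ℝ) • algebraMap ℝ A (QuadraticMap.weightedSumSquares ℝ w v) := by
      rw [two_smul]
      nth_rewrite 1 [h1]
      rw [h2, ← Finset.sum_add_distrib, QuadraticMap.weightedSumSquares_apply, map_sum,
        Finset.smul_sum]
      refine Finset.sum_congr rfl fun a _ => ?_
      rw [← Finset.sum_add_distrib, Finset.sum_eq_single a]
      · rw [hsq, ← two_smul ℝ, Algebra.algebraMap_eq_smul_one, Algebra.algebraMap_eq_smul_one,
          smul_smul, smul_smul, smul_smul]
        congr 1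
        rw [smul_eq_mul]
        ring
      · intro b _ hb
        rw [hanti a b hb.symm, smul_neg, neg_add_cancel]
      · simp
    exact smul_right_injective A (two_ne_zero (α := ℝ)) h3
  refine ⟨lift _ ⟨l, hl⟩, fun a => ?_⟩
  rw [gen, lift_ι_apply]
  simp [l, Fintype.linearCombination_apply_single]

/-- Two real-linear anti-multiplicative maps that are intertwined on generators are intertwined. -/
theorem intertwine_of_gen [Fintype κ] [DecidableEq κ] {w : κ → ℝ}
    (f : CliffordAlgebra (QuadraticMap.weightedSumSquares ℝ w) →ₐ[ℝ] A)
    (τ : CliffordAlgebra (QuadraticMap.weightedSumSquares ℝ w) →ₗ[ℝ]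
      CliffordAlgebra (QuadraticMap.weightedSumSquares ℝ w)) (θ : A →ₗ[ℝ] A) (S : A)
    (hτ1 : τ 1 = 1) (hτ : ∀ x y, τ (x * y) = τ y * τ x) (hθ1 : θ 1 = 1)
    (hθ : ∀ x y, θ (x * y) = θ y * θ x)
    (h : ∀ a, S * f (τ (gen w a)) = θ (f (gen w a)) * S) (x) :
    S * f (τ x) = θ (f x) * S := by
  have hx : x ∈ Algebra.adjoin ℝ (Set.range (gen w)) := by rw [adjoin_range_gen]; trivial
  induction hx using Algebra.adjoin_induction with
  | mem x hx => obtain ⟨a, rfl⟩ := hx; exact h a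
  | algebraMap r => simp [Algebra.algebraMap_eq_smul_one, hτ1, hθ1]
  | add x y _ _ hx hy => simp only [map_add, mul_add, add_mul, hx, hy]
  | mul x y _ _ hx hy =>
    rw [hτ, map_mul, ← mul_assoc, hy, mul_assoc, hx, map_mul, hθ, mul_assoc]

/-- The product of the generators in a finite set. -/
theorem exists_product [DecidableEq κ] {w : κ → ℝ} {E : κ → A} (hsq : ∀ a, E a * E a = algebraMap ℝ A (w a))
    (hanti : ∀ a b, a ≠ b → E a * E b = -(E b * E a)) (B : Finset κ) :
    ∃ S ∈ Submonoid.closure (Set.range E),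
      (∀ a ∉ B, S * E a = (-1 : ℝ) ^ B.card • (E a * S)) ∧
      (∀ a ∈ B, S * E a = (-1 : ℝ) ^ (B.card + 1) • (E a * S)) ∧
      S * S = ((-1 : ℝ) ^ (B.card.choose 2) * ∏ a ∈ B, w a) • 1 := by
  induction B using Finset.induction_on with
  | empty => exact ⟨1, one_mem _, by simp, by simp, by simp⟩
  | insert b B hb ih =>
    obtain ⟨S, hS, h1, h2, h3⟩ := ih
    have h1b := h1 b hb
    refine ⟨S * E b, mul_mem hS (Submonoid.subset_closure ⟨b, rfl⟩), ?_, ?_, ?_⟩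
    · intro a ha
      rw [Finset.mem_insert, not_or] at ha
      rw [mul_assoc, hanti b a (Ne.symm ha.1), mul_neg, ← mul_assoc, h1 a ha.2,
        Finset.card_insert_of_notMem hb, pow_succ]
      simp [mul_assoc]
    · intro a ha
      rw [Finset.card_insert_of_notMem hb, pow_succ, pow_succ]
      rcases Finset.mem_insert.1 ha with rfl | ha
      · rw [mul_assoc, ← mul_assoc (E a)]
        have : E a * S = (-1 : ℝ) ^ B.card • (S * E a) := by
          rw [h1b, smul_smul, ← mul_pow]; simp
        rw [this, smul_mul_assoc, smul_smul, mul_assoc S]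
        rw [show (-1 : ℝ) ^ B.card * -1 * -1 * (-1) ^ B.card = ((-1) * (-1)) ^ B.card by
          rw [mul_pow]; ring]
        simp
      · have hab : b ≠ a := fun h => hb (h ▸ ha)
        rw [mul_assoc, hanti b a hab, mul_neg, ← mul_assoc, h2 a ha, pow_succ]
        simp [mul_assoc]
    -- Moving `E b` past the old product costs `(-1)^k`, where `k` is the size of `B`; this matches
    -- `C(k+1, 2) = k + C(k, 2)`.
    · have : E b * S = (-1 : ℝ) ^ B.card • (S * E b) := by
        rw [h1b, smul_smul, ← mul_pow]; simp
      rw [mul_assoc, ← mul_assoc (E b), this, smul_mul_assoc, mul_assoc S, hsq, mul_smul_comm,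
        ← mul_assoc, h3, Finset.card_insert_of_notMem hb, Finset.prod_insert hb,
        Algebra.algebraMap_eq_smul_one, smul_mul_smul_comm, smul_smul, one_mul,
        Nat.choose_succ_succ' B.card 1, Nat.choose_one_right, pow_add]
      congr 1
      ring

/-- The Clifford algebra is linearly isomorphic to the exterior algebra, whose basis is indexed by
subsets. The dimension later turns surjectivity of the representation into bijectivity. -/
theorem finrank_cliffordAlgebra [Fintype κ] (w : κ → ℝ) :
    Module.Finite ℝ (CliffordAlgebra (QuadraticMap.weightedSumSquares ℝ w)) ∧
      Module.finrank ℝ (CliffordAlgebra (QuadraticMap.weightedSumSquares ℝ w)) =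
        2 ^ Fintype.card κ := by
  let b : Module.Basis (Finset (Fin (Fintype.card κ))) ℝ
      (CliffordAlgebra (QuadraticMap.weightedSumSquares ℝ w)) :=
    (((Pi.basisFun ℝ κ).reindex (Fintype.equivFin κ)).ExteriorAlgebra).map
      (equivExterior (QuadraticMap.weightedSumSquares ℝ w)).symm
  exact ⟨Module.Finite.of_basis b, by rw [Module.finrank_eq_card_basis b]; simp⟩

end Orthogonal

end CliffordGroups

/-! ### Gamma matrices -/

namespace CliffordGroups

open Matrix

/-- Anticommuting Hermitian complex matrices of square `1` that generate the matrix algebra. -/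
structure GammaSystem (κ ι : Type) [Fintype ι] [DecidableEq ι] where
  F : κ → Matrix ι ι ℂ
  sq : ∀ a, F a * F a = 1
  anti : ∀ a b, a ≠ b → F a * F b = -(F b * F a)
  herm : ∀ a, (F a)ᴴ = F a
  adjoin : Algebra.adjoin ℂ (Set.range F) = ⊤

namespace GammaSystem

/-- The one-dimensional system. -/
def unit : GammaSystem Unit Unit where
  F _ := 1
  sq _ := one_mul 1
  anti a b h := absurd (Subsingleton.elim a b) h
  herm _ := conjTranspose_one
  adjoin := by
    rw [eq_top_iff]
    intro X _
    have : X = algebraMap ℂ _ (X () ()) := by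
      ext ⟨⟩ ⟨⟩
      simp [Matrix.algebraMap_matrix_apply]
    rw [this]
    exact Subalgebra.algebraMap_mem _ _

section double

variable {κ ι : Type} [Fintype ι] [DecidableEq ι]

/-- The family of block matrices that doubles the size and adds two members. -/
def doubleF (F : κ → Matrix ι ι ℂ) : κ ⊕ Bool → Matrix (ι ⊕ ι) (ι ⊕ ι) ℂ
  -- In terms of Pauli matrices: `σ_x ⊗ F a`, then `σ_y ⊗ 1` and `σ_z ⊗ 1`.
  | .inl a => fromBlocks 0 (F a) (F a) 0
  | .inr false => fromBlocks 0 (-Complex.I • 1) (Complex.I • 1) 0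
  | .inr true => fromBlocks 1 0 0 (-1)

/-- The product of `σ_z` and `σ_y` yields `σ_x`, and `(1 + σ_z)/2` is the projection to the first
summand. Multiplying `σ_x ⊗ F a` by `σ_x` gives `1 ⊗ F a`, hence `1 ⊗ X` for every `X`. -/
theorem adjoin_doubleF [Nonempty κ] (Γ : GammaSystem κ ι) :
    Algebra.adjoin ℂ (Set.range (doubleF Γ.F)) = ⊤ := by
  set R := Algebra.adjoin ℂ (Set.range (doubleF Γ.F))
  have hmem : ∀ a, doubleF Γ.F a ∈ R := fun a => Algebra.subset_adjoin (Set.mem_range_self a)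
  have hz : (fromBlocks 1 0 0 (-1) : Matrix (ι ⊕ ι) (ι ⊕ ι) ℂ) ∈ R := hmem (.inr true)
  have hy : (fromBlocks 0 (-Complex.I • 1) (Complex.I • 1) 0 : Matrix (ι ⊕ ι) (ι ⊕ ι) ℂ) ∈ R :=
    hmem (.inr false)
  have hx : (fromBlocks 0 1 1 0 : Matrix (ι ⊕ ι) (ι ⊕ ι) ℂ) ∈ R := by
    have := R.smul_mem (R.mul_mem hz hy) Complex.I
    simpa [fromBlocks_multiply, fromBlocks_smul, smul_smul] using this
  have hp : (fromBlocks 1 0 0 0 : Matrix (ι ⊕ ι) (ι ⊕ ι) ℂ) ∈ R := by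
    have := R.smul_mem (R.add_mem R.one_mem hz) (1 / 2 : ℂ)
    rw [← fromBlocks_one, fromBlocks_add, fromBlocks_smul] at this
    convert this using 2 <;> simp [← two_smul ℂ, smul_smul]
  have hd : ∀ X : Matrix ι ι ℂ, (fromBlocks X 0 0 X : Matrix (ι ⊕ ι) (ι ⊕ ι) ℂ) ∈ R := by
    intro X
    have hX : X ∈ Algebra.adjoin ℂ (Set.range Γ.F) := by rw [Γ.adjoin]; trivial
    induction hX using Algebra.adjoin_induction with
    | mem X hX =>
      obtain ⟨a, rfl⟩ := hX
      simpa [doubleF, fromBlocks_multiply] using R.mul_mem (hmem (.inl a)) hx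
    | algebraMap r =>
      have := R.smul_mem R.one_mem r
      rw [← fromBlocks_one, fromBlocks_smul] at this
      simpa [Algebra.algebraMap_eq_smul_one] using this
    | add X Y _ _ hX hY => simpa [fromBlocks_add] using R.add_mem hX hY
    | mul X Y _ _ hX hY => simpa [fromBlocks_multiply] using R.mul_mem hX hY
  rw [eq_top_iff]
  intro X _
  -- The projection selects a summand and `σ_x` exchanges the two, so every block of `X` can be put
  -- in place separately.
  have h11 := R.mul_mem (hd X.toBlocks₁₁) hp
  have h12 := R.mul_mem (R.mul_mem hp (hd X.toBlocks₁₂)) hx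
  have h21 := R.mul_mem (R.mul_mem hx (hd X.toBlocks₂₁)) hp
  have h22 := R.mul_mem (R.mul_mem (R.mul_mem hx (hd X.toBlocks₂₂)) hp) hx
  rw [← fromBlocks_toBlocks X]
  simpa [fromBlocks_multiply, fromBlocks_add] using
    R.add_mem (R.add_mem (R.add_mem h11 h12) h21) h22

/-- Doubling of the matrix size adds two members to a system. -/
def double [Nonempty κ] (Γ : GammaSystem κ ι) : GammaSystem (κ ⊕ Bool) (ι ⊕ ι) where
  F := doubleF Γ.F
  sq := by
    rintro (a | _ | _) <;> simp [doubleF, fromBlocks_multiply, Γ.sq, smul_smul]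
  anti := by
    rintro (a | _ | _) (b | _ | _) h <;>
      simp_all [doubleF, fromBlocks_multiply, fromBlocks_neg]
    exact Γ.anti a b h
  herm := by
    rintro (a | _ | _) <;>
      simp [doubleF, fromBlocks_conjTranspose, Γ.herm, conjTranspose_smul]
  adjoin := adjoin_doubleF Γ

end double

end GammaSystem

/-! ### Matrices intertwining the gamma matrices with their transposes -/

/-- A matrix that is congruent to the standard alternating form by a permutation and a symmetric
block. -/
def IsAltBlock {ι : Type} (C : Matrix ι ι ℂ) : Prop :=
  ∃ (ι' : Type) (_ : Fintype ι') (_ : DecidableEq ι') (e : ι ≃ ι' ⊕ ι') (D : Matrix ι' ι' ℂ),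
    Dᵀ = D ∧ IsUnit D ∧ C = (fromBlocks 0 (-D) D 0).submatrix e e

theorem IsAltBlock.transpose_eq {ι : Type} {C : Matrix ι ι ℂ} (h : IsAltBlock C) : Cᵀ = -C := by
  obtain ⟨ι', _, _, e, D, hD, -, rfl⟩ := h
  ext i j
  have := congrFun (congrFun (fromBlocks_transpose (0 : Matrix ι' ι' ℂ) (-D) D 0) (e i)) (e j)
  rw [transpose_zero, transpose_neg, hD] at this
  rw [transpose_submatrix, submatrix_apply, this, neg_apply, submatrix_apply, ← neg_apply,
    fromBlocks_neg]
  simp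

theorem isUnit_of_fromBlocks_antidiag {ι : Type} [Fintype ι] [DecidableEq ι]
    {B C : Matrix ι ι ℂ} (hB : IsUnit B) (hC : IsUnit C) : IsUnit (fromBlocks 0 B C 0) := by
  obtain ⟨B', hB1, hB2⟩ := isUnit_iff_exists.1 hB
  obtain ⟨C', hC1, hC2⟩ := isUnit_iff_exists.1 hC
  refine isUnit_iff_exists.2 ⟨fromBlocks 0 C' B' 0, ?_, ?_⟩ <;>
    simp [fromBlocks_multiply, *]

theorem isUnit_of_fromBlocks_diag {ι : Type} [Fintype ι] [DecidableEq ι]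
    {B C : Matrix ι ι ℂ} (hB : IsUnit B) (hC : IsUnit C) : IsUnit (fromBlocks B 0 0 C) := by
  obtain ⟨B', hB1, hB2⟩ := isUnit_iff_exists.1 hB
  obtain ⟨C', hC1, hC2⟩ := isUnit_iff_exists.1 hC
  refine isUnit_iff_exists.2 ⟨fromBlocks B' 0 0 C', ?_, ?_⟩ <;>
    simp [fromBlocks_multiply, *]

/-- Each doubling must flip the sign in `C F = ± Fᵀ C`. Since `σ_x` and `σ_z` are symmetric and
`σ_y` is antisymmetric, tensoring `C` with a multiple of `σ_y` does this for even `m`, and tensoring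
with `σ_z` for odd `m`. The former exchanges symmetric and antisymmetric, the latter preserves the
type; hence period four. -/
theorem exists_gammaSystem (m : ℕ) :
    ∃ (κ ι : Type) (_ : Fintype κ) (_ : Nonempty κ) (_ : Fintype ι) (_ : DecidableEq ι)
      (Γ : GammaSystem κ ι) (C : Matrix ι ι ℂ),
      Fintype.card κ = 2 * m + 1 ∧ Fintype.card ι = 2 ^ m ∧
      (∀ a, C * Γ.F a = (-1 : ℝ) ^ m • ((Γ.F a)ᵀ * C)) ∧ IsUnit C ∧
      (m % 4 = 0 ∨ m % 4 = 3 → Cᵀ = C) ∧ (m % 4 = 1 ∨ m % 4 = 2 → IsAltBlock C) := by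
  induction m with
  | zero =>
    exact ⟨Unit, Unit, inferInstance, inferInstance, inferInstance, inferInstance,
      GammaSystem.unit, 1, by simp, by simp, by simp [GammaSystem.unit], isUnit_one, by simp,
      by simp⟩
  | succ m ih =>
    obtain ⟨κ, ι, _, _, _, _, Γ, C, hκ, hι, hC, hu, hs, ha⟩ := ih
    refine ⟨κ ⊕ Bool, ι ⊕ ι, inferInstance, inferInstance, inferInstance, inferInstance, Γ.double,
      if Even m then fromBlocks 0 (-C) C 0 else fromBlocks C 0 0 (-C), ?_, ?_, ?_, ?_, ?_, ?_⟩
    · simp [hκ]; ring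
    · simp [hι]; ring
    · split_ifs with h
      · rw [Even.neg_one_pow h] at hC
        rw [pow_succ, Even.neg_one_pow h]
        rintro (a | _ | _) <;>
          simp [GammaSystem.double, GammaSystem.doubleF, fromBlocks_multiply, fromBlocks_transpose,
            hC, fromBlocks_neg]
      · rw [Nat.not_even_iff_odd] at h
        rw [Odd.neg_one_pow h] at hC
        rw [pow_succ, Odd.neg_one_pow h]
        rintro (a | _ | _) <;>
          simp [GammaSystem.double, GammaSystem.doubleF, fromBlocks_multiply, fromBlocks_transpose,
            hC]
    · split_ifs
      · exact isUnit_of_fromBlocks_antidiag hu.neg hu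
      · exact isUnit_of_fromBlocks_diag hu hu.neg
    · intro h
      split_ifs with hm
      · have : m % 4 = 2 := by rw [Nat.even_iff] at hm; omega
        have hCa := (ha (Or.inr this)).transpose_eq
        simp [fromBlocks_transpose, hCa]
      · have : m % 4 = 3 := by rw [Nat.even_iff] at hm; omega
        simp [fromBlocks_transpose, hs (Or.inr this)]
    · intro h
      split_ifs with hm
      · have : m % 4 = 0 := by rw [Nat.even_iff] at hm; omega
        exact ⟨ι, inferInstance, inferInstance, Equiv.refl _, C, hs (Or.inl this), hu, by simp⟩
      · have : m % 4 = 1 := by rw [Nat.even_iff] at hm; omega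
        obtain ⟨ι', _, _, e, D, hD, hDu, rfl⟩ := ha (Or.inl this)
        -- Exchanging the two middle summands turns `diag(C, -C)` into an alternating block matrix
        -- whose symmetric block is `diag(D, -D)`.
        refine ⟨ι' ⊕ ι', inferInstance, inferInstance,
          (Equiv.sumCongr e e).trans (Equiv.sumSumSumComm ι' ι' ι' ι'), fromBlocks D 0 0 (-D),
          by simp [fromBlocks_transpose, hD], isUnit_of_fromBlocks_diag hDu hDu.neg, ?_⟩
        ext (i | i) (j | j) <;> rcases hi : e i with x | x <;> rcases hj : e j with y | y <;>
          simp [hi, hj, Equiv.sumSumSumComm]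

end CliffordGroups

/-! ### Normal forms under congruence -/

namespace CliffordGroups

open Matrix

/-- Complex symmetric invertible matrices are congruent to the identity. -/
theorem exists_transpose_mul_self {ι : Type} [Fintype ι] [DecidableEq ι] {C : Matrix ι ι ℂ}
    (hC : Cᵀ = C) (hu : IsUnit C) {r : ℕ} (hr : Fintype.card ι = r) :
    ∃ (P : Matrix (Fin r) ι ℂ) (Q : Matrix ι (Fin r) ℂ), P * Q = 1 ∧ Q * P = 1 ∧ Pᵀ * P = C := by
  -- The isometry with a sum of squares is indexed by `Fin` of the dimension, so `r` is replaced by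
  -- it.
  obtain rfl : Module.finrank ℂ (ι → ℂ) = r := by simp [hr]
  let B : LinearMap.BilinForm ℂ (ι → ℂ) := Matrix.toLinearMap₂' ℂ C
  have hBC : ∀ i j, B (Pi.single i 1) (Pi.single j 1) = C i j := fun i j => by
    simp [B, Matrix.toLinearMap₂'_apply']
  have hsymm : ∀ x y, B x y = B y x := by
    intro x y
    simp only [B, Matrix.toLinearMap₂'_apply']
    rw [dotProduct_mulVec, ← mulVec_transpose, hC, dotProduct_comm]
  have hassoc : QuadraticMap.associated (R := ℂ) (LinearMap.BilinMap.toQuadraticMap B) = B :=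
    QuadraticMap.associated_left_inverse ℂ hsymm
  obtain ⟨e⟩ := QuadraticForm.equivalent_weightedSumSquares_of_isAlgClosed
    (LinearMap.BilinMap.toQuadraticMap B) (by
      rw [hassoc]
      refine LinearMap.separatingLeft_toLinearMap₂'_of_det_ne_zero' ?_
      exact ((Matrix.isUnit_iff_isUnit_det C).1 hu).ne_zero)
  have key : ∀ x, e x ⬝ᵥ e x = B x x := by
    intro x
    have := e.map_app x
    rw [QuadraticMap.weightedSumSquares_apply] at this
    simpa [dotProduct] using this
  -- The isometry respects only the quadratic forms; polarisation recovers the bilinear ones.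
  have hpol : ∀ x y, e x ⬝ᵥ e y = B x y := by
    intro x y
    have h := key (x + y)
    have ha : e (x + y) = e x + e y := e.toLinearEquiv.map_add x y
    rw [ha, add_dotProduct, dotProduct_add, dotProduct_add, key, key,
      dotProduct_comm (e y) (e x)] at h
    simp only [map_add, LinearMap.add_apply] at h
    rw [hsymm y x] at h
    linear_combination h / 2
  let f : (ι → ℂ) ≃ₗ[ℂ] (Fin (Module.finrank ℂ (ι → ℂ)) → ℂ) := e.toLinearEquiv
  refine ⟨LinearMap.toMatrix' f.toLinearMap, LinearMap.toMatrix' f.symm.toLinearMap, ?_, ?_, ?_⟩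
  · rw [← LinearMap.toMatrix'_comp]; simp
  · rw [← LinearMap.toMatrix'_comp]; simp
  · ext i j
    rw [← hBC, ← hpol, mul_apply]
    simp only [transpose_apply, LinearMap.toMatrix'_apply, dotProduct]
    rfl

/-- If `PᵀP = D`, then `diag(P, P)` carries the standard alternating form to the one with block `D`.
This reduces the alternating case to the symmetric one. -/
theorem IsAltBlock.exists_congruent_J {ι : Type} [Fintype ι] [DecidableEq ι] {C : Matrix ι ι ℂ}
    (hC : IsAltBlock C) {r : ℕ} (hr : Fintype.card ι = r + r) :
    ∃ (P : Matrix (Fin r ⊕ Fin r) ι ℂ) (Q : Matrix ι (Fin r ⊕ Fin r) ℂ),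
      P * Q = 1 ∧ Q * P = 1 ∧ Pᵀ * J (Fin r) ℂ * P = C := by
  obtain ⟨ι', _, _, e, D, hD, hDu, rfl⟩ := hC
  have hr' : Fintype.card ι' = r := by
    have := Fintype.card_congr e
    rw [Fintype.card_sum] at this
    omega
  obtain ⟨P, Q, hPQ, hQP, hPD⟩ := exists_transpose_mul_self hD hDu hr'
  refine ⟨(fromBlocks P 0 0 P).submatrix id e, (fromBlocks Q 0 0 Q).submatrix e id, ?_, ?_, ?_⟩
  · rw [submatrix_mul_equiv _ _ id e id]
    simp [fromBlocks_multiply, hPQ]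
  · rw [← submatrix_mul _ _ e id e Function.bijective_id]
    simp [fromBlocks_multiply, hQP]
  · rw [transpose_submatrix, J, ← submatrix_id_id (fromBlocks 0 (-1) 1 0),
      ← submatrix_mul _ _ e id id Function.bijective_id,
      ← submatrix_mul _ _ e id e Function.bijective_id]
    simp [fromBlocks_transpose, fromBlocks_multiply, hPD]

/-- The diagonal matrix `diag(1, …, 1, -1, …, -1)`. -/
def signMatrix (r s : ℕ) : Matrix (Fin r ⊕ Fin s) (Fin r ⊕ Fin s) ℂ :=
  fromBlocks 1 0 0 (-1)

/-- A Hermitian involution that anticommutes with another involution has balanced signature. -/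
theorem exists_congruent_balanced {ι : Type} [Fintype ι] [DecidableEq ι] {H G : Matrix ι ι ℂ}
    (hH : Hᴴ = H) (hH2 : H * H = 1) (hG : G * G = 1) (hHG : H * G = -(G * H)) {r : ℕ}
    (hr : Fintype.card ι = r + r) :
    ∃ (P : Matrix (Fin r ⊕ Fin r) ι ℂ) (Q : Matrix ι (Fin r ⊕ Fin r) ℂ),
      P * Q = 1 ∧ Q * P = 1 ∧ Pᴴ * signMatrix r r * P = H := by
  -- Conjugation by `G` sends `H` to `-H`.
  have htr : H.trace = 0 := by
    have h1 : (G * (H * G)).trace = H.trace := by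
      rw [trace_mul_comm, mul_assoc, hG, mul_one]
    rw [hHG, mul_neg, ← mul_assoc, hG, one_mul, trace_neg] at h1
    linear_combination -(1 / 2 : ℂ) * h1
  have hHh : H.IsHermitian := hH
  let U : Matrix ι ι ℂ := hHh.eigenvectorUnitary
  have hU1 : U * Uᴴ = 1 := Unitary.coe_mul_star_self hHh.eigenvectorUnitary
  have hU2 : Uᴴ * U = 1 := Unitary.coe_star_mul_self hHh.eigenvectorUnitary
  let l : ι → ℂ := RCLike.ofReal ∘ hHh.eigenvalues
  have hsp : H = U * diagonal l * Uᴴ := by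
    have := hHh.spectral_theorem
    rwa [Unitary.conjStarAlgAut_apply] at this
  have hdiag : diagonal l = Uᴴ * H * U := by
    rw [hsp]
    simp only [← mul_assoc, hU2, one_mul]
    rw [mul_assoc, hU2, mul_one]
  have hl2 : ∀ i, l i * l i = 1 := by
    have h : diagonal l * diagonal l = 1 := by
      rw [hdiag, show Uᴴ * H * U * (Uᴴ * H * U) = Uᴴ * H * (U * Uᴴ) * H * U by
        simp only [mul_assoc], hU1, mul_one, mul_assoc Uᴴ, hH2, mul_one, hU2]
    intro i
    have := congrFun (congrFun h i) i
    simpa [diagonal_mul_diagonal] using this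
  have hl : ∀ i, l i = 1 ∨ l i = -1 := fun i => mul_self_eq_one_iff.1 (hl2 i)
  have hsum : ∑ i, l i = 0 := by
    rw [← trace_diagonal, hdiag, trace_mul_comm, ← mul_assoc, hU1, one_mul, htr]
  -- The eigenvalues are `±1` with sum zero, so both signs occur equally often.
  have hcount : Fintype.card {i // l i = 1} = Fintype.card {i // ¬ l i = 1} := by
    have h1 : ∀ i, l i = (if l i = 1 then 1 else 0) - (if ¬ l i = 1 then 1 else 0) := by
      intro i
      rcases hl i with h | h <;> rw [h] <;> norm_num
    rw [Finset.sum_congr rfl fun i _ => h1 i, Finset.sum_sub_distrib, Finset.sum_boole,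
      Finset.sum_boole, sub_eq_zero] at hsum
    rw [Fintype.card_subtype, Fintype.card_subtype]
    exact_mod_cast hsum
  have hcard : Fintype.card {i // l i = 1} + Fintype.card {i // ¬ l i = 1} = r + r := by
    rw [← Fintype.card_sum, ← hr]
    exact Fintype.card_congr (Equiv.sumCompl fun i => l i = 1)
  let e1 : {i // l i = 1} ≃ Fin r := Fintype.equivFinOfCardEq (by omega)
  let e2 : {i // ¬ l i = 1} ≃ Fin r := Fintype.equivFinOfCardEq (by omega)
  let e : Fin r ⊕ Fin r ≃ ι := (Equiv.sumCongr e1.symm e2.symm).trans (Equiv.sumCompl _)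
  have he : (diagonal l).submatrix e e = signMatrix r r := by
    rw [signMatrix, submatrix_diagonal_equiv, ← diagonal_one, diagonal_neg, fromBlocks_diagonal]
    congr 1
    ext (i | i)
    · exact (e1.symm i).2
    · exact (hl _).resolve_left (e2.symm i).2
  refine ⟨Uᴴ.submatrix e id, U.submatrix id e, ?_, ?_, ?_⟩
  · rw [← submatrix_mul _ _ e id e Function.bijective_id, hU2, submatrix_one_equiv]
  · rw [submatrix_mul_equiv _ _ id e id, hU1, submatrix_id_id]
  · rw [← he, conjTranspose_submatrix, conjTranspose_conjTranspose,
      submatrix_mul_equiv, submatrix_mul_equiv, ← hsp, submatrix_id_id]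

end CliffordGroups

/-! ### The matrix representation -/

namespace CliffordGroups

open Matrix CliffordAlgebra

section

variable {κ ι : Type} [Fintype ι] [DecidableEq ι]

/-- Change of the index type of a system. -/
def GammaSystem.reindex {κ' : Type} (Γ : GammaSystem κ ι) (e : κ' ≃ κ) : GammaSystem κ' ι where
  F a := Γ.F (e a)
  sq a := Γ.sq (e a)
  anti a b h := Γ.anti _ _ (e.injective.ne h)
  herm a := Γ.herm (e a)
  adjoin := by
    rw [← Γ.adjoin]
    congr 1
    exact e.surjective.range_comp Γ.F

/-- A square root of a sign. -/
noncomputable def signRoot (w : ℝ) : ℂ := if w = 1 then 1 else Complex.I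

theorem signRoot_mul_self {w : ℝ} (hw : w = 1 ∨ w = -1) : signRoot w * signRoot w = w := by
  rcases hw with rfl | rfl
  · simp [signRoot]
  · rw [signRoot, if_neg (by norm_num), Complex.I_mul_I]; simp

theorem signRoot_ne_zero (w : ℝ) : signRoot w ≠ 0 := by
  rw [signRoot]; split_ifs <;> simp

theorem star_signRoot {w : ℝ} (hw : w = 1 ∨ w = -1) : star (signRoot w) = w * signRoot w := by
  rcases hw with rfl | rfl
  · simp [signRoot]
  · rw [signRoot, if_neg (by norm_num)]; simp

/-- The members of a system, rescaled so that their squares are the given signs. -/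
noncomputable def GammaSystem.twist (Γ : GammaSystem κ ι) (w : κ → ℝ) (a : κ) : Matrix ι ι ℂ :=
  signRoot (w a) • Γ.F a

variable {w : κ → ℝ} (Γ : GammaSystem κ ι)

theorem GammaSystem.twist_sq (hw : ∀ a, w a = 1 ∨ w a = -1) (a : κ) :
    Γ.twist w a * Γ.twist w a = algebraMap ℝ (Matrix ι ι ℂ) (w a) := by
  rw [twist, smul_mul_smul_comm, Γ.sq, signRoot_mul_self (hw a), Algebra.algebraMap_eq_smul_one]
  ext i j
  simp

theorem GammaSystem.twist_anti (a b : κ) (h : a ≠ b) :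
    Γ.twist w a * Γ.twist w b = -(Γ.twist w b * Γ.twist w a) := by
  rw [twist, twist, smul_mul_smul_comm, smul_mul_smul_comm, Γ.anti a b h, smul_neg,
    mul_comm (signRoot (w b))]

theorem GammaSystem.conjTranspose_twist (hw : ∀ a, w a = 1 ∨ w a = -1) (a : κ) :
    (Γ.twist w a)ᴴ = w a • Γ.twist w a := by
  rw [twist, conjTranspose_smul, Γ.herm, star_signRoot (hw a)]
  ext i j
  simp [mul_assoc]

/-- A real subalgebra that contains a central square root of `-1` and the rescaled members is
everything. -/
theorem GammaSystem.eq_top_of_mem (R : Subalgebra ℝ (Matrix ι ι ℂ))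
    (hI : (Complex.I • 1 : Matrix ι ι ℂ) ∈ R) (hE : ∀ a, Γ.twist w a ∈ R) : R = ⊤ := by
  have hsmul : ∀ (c : ℂ) (X : Matrix ι ι ℂ), X ∈ R → c • X ∈ R := by
    intro c X hX
    have h : c • X = c.re • X + c.im • ((Complex.I • 1 : Matrix ι ι ℂ) * X) := by
      ext i j
      simp only [Matrix.add_apply, Matrix.smul_apply, smul_mul_assoc, Matrix.one_mul, smul_eq_mul,
        Complex.real_smul]
      linear_combination -(X i j) * Complex.re_add_im c
    rw [h]
    exact add_mem (R.smul_mem hX _) (R.smul_mem (mul_mem hI hX) _)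
  -- Closed under complex scalars, `R` is a complex subalgebra; the factors `signRoot` can then be
  -- divided out.
  let R' : Subalgebra ℂ (Matrix ι ι ℂ) :=
    { R.toSubsemiring with
      algebraMap_mem' := fun c => by
        rw [Algebra.algebraMap_eq_smul_one]
        exact hsmul c 1 (one_mem R) }
  have hR' : R' = ⊤ := by
    rw [eq_top_iff, ← Γ.adjoin]
    refine Algebra.adjoin_le ?_
    rintro _ ⟨a, rfl⟩
    have := hsmul (signRoot (w a))⁻¹ _ (hE a)
    rwa [twist, smul_smul, inv_mul_cancel₀ (signRoot_ne_zero _), one_smul] at this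
  rw [eq_top_iff]
  intro X _
  have : X ∈ R' := by rw [hR']; trivial
  exact this

/-- The `F a` generate the matrix algebra, so `S` is central and therefore scalar. -/
theorem GammaSystem.exists_smul_one_of_commute {S : Matrix ι ι ℂ}
    (hS : ∀ a, Commute (Γ.F a) S) : ∃ c : ℂ, c • 1 = S := by
  have h : S ∈ Subalgebra.center ℂ (Matrix ι ι ℂ) := by
    rw [Subalgebra.mem_center_iff]
    intro X
    have hX : X ∈ Algebra.adjoin ℂ (Set.range Γ.F) := by rw [Γ.adjoin]; trivial
    induction hX using Algebra.adjoin_induction with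
    | mem X hX => obtain ⟨a, rfl⟩ := hX; exact hS a
    | algebraMap r => exact Algebra.commutes r S
    | add X Y _ _ hX hY => rw [add_mul, mul_add, hX, hY]
    | mul X Y _ _ hX hY => rw [mul_assoc, hY, ← mul_assoc, hX, mul_assoc]
  rw [Algebra.IsCentral.center_eq_bot] at h
  obtain ⟨c, hc⟩ := Algebra.mem_bot.1 h
  exact ⟨c, by rw [← hc, Algebra.algebraMap_eq_smul_one]⟩

/-- The number of generators is odd, so the product of all of them is central, hence a scalar; its
square is `-1` by `hprod`, so it is `±i`. The image therefore contains `i` and is everything, and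
both real dimensions are `2^(2m+1)`. -/
theorem GammaSystem.exists_algEquiv [Fintype κ] [DecidableEq κ]
    (hw : ∀ a, w a = 1 ∨ w a = -1) {m : ℕ}
    (hκ : Fintype.card κ = 2 * m + 1) (hι : Fintype.card ι = 2 ^ m)
    (hprod : (-1 : ℝ) ^ (2 * m + 1).choose 2 * ∏ a, w a = -1) :
    ∃ β : CliffordAlgebra (QuadraticMap.weightedSumSquares ℝ w) ≃ₐ[ℝ] Matrix ι ι ℂ,
      ∀ a, β (gen w a) = Γ.twist w a := by
  have hne : Nonempty ι := Fintype.card_pos_iff.1 (by rw [hι]; positivity)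
  obtain ⟨f, hf⟩ := exists_algHom_gen (Γ.twist_sq hw) (Γ.twist_anti (w := w))
  have hmem : ∀ a, Γ.twist w a ∈ f.range := fun a => ⟨_, hf a⟩
  obtain ⟨S, hS, -, h1, h2⟩ :=
    exists_product (Γ.twist_sq hw) (Γ.twist_anti (w := w)) Finset.univ
  have hSf : S ∈ f.range := by
    refine (Submonoid.closure_le (S := f.range.toSubsemiring.toSubmonoid)).2 ?_ hS
    rintro _ ⟨a, rfl⟩
    exact hmem a
  have hcomm : ∀ a, Commute (Γ.F a) S := by
    intro a
    have h := h1 a (Finset.mem_univ a)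
    rw [Finset.card_univ, hκ, Even.neg_one_pow ⟨m + 1, by ring⟩, one_smul, twist, smul_mul_assoc,
      mul_smul_comm] at h
    exact (smul_right_injective _ (signRoot_ne_zero _) h).symm
  obtain ⟨c, rfl⟩ := Γ.exists_smul_one_of_commute hcomm
  have hc : c * c = Complex.I * Complex.I := by
    rw [Finset.card_univ, hκ, hprod, smul_mul_smul_comm, one_mul] at h2
    have := congrFun (congrFun h2 hne.some) hne.some
    simpa using this
  have hI : (Complex.I • 1 : Matrix ι ι ℂ) ∈ f.range := by
    rcases mul_self_eq_mul_self_iff.1 hc with rfl | rfl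
    · exact hSf
    · have := neg_mem hSf
      rwa [neg_smul, neg_neg] at this
  have hsurj : Function.Surjective f := by
    rw [← AlgHom.range_eq_top]
    exact Γ.eq_top_of_mem _ hI hmem
  obtain ⟨hfin, hrank⟩ := finrank_cliffordAlgebra w
  have hrank' : Module.finrank ℝ (Matrix ι ι ℂ) = 2 ^ Fintype.card κ := by
    rw [Module.finrank_matrix, Complex.finrank_real_complex, hι, hκ]
    ring
  have hinj : Function.Injective f :=
    (LinearMap.injective_iff_surjective_of_finrank_eq_finrank (f := f.toLinearMap)
      (hrank.trans hrank'.symm)).2 hsurj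
  exact ⟨AlgEquiv.ofBijective f ⟨hinj, hsurj⟩, hf⟩

end

/-- An invertible congruence induces an isomorphism of matrix algebras. -/
def congrAlgEquiv {ι ι' : Type} [Fintype ι] [DecidableEq ι] [Fintype ι'] [DecidableEq ι']
    (P : Matrix ι' ι ℂ) (Q : Matrix ι ι' ℂ) (hPQ : P * Q = 1) (hQP : Q * P = 1) :
    Matrix ι ι ℂ ≃ₐ[ℝ] Matrix ι' ι' ℂ where
  toFun X := P * X * Q
  invFun Y := Q * Y * P
  left_inv X := by
    change Q * (P * X * Q) * P = X
    rw [show Q * (P * X * Q) * P = (Q * P) * X * (Q * P) by simp only [Matrix.mul_assoc], hQP,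
      Matrix.one_mul, Matrix.mul_one]
  right_inv Y := by
    change P * (Q * Y * P) * Q = Y
    rw [show P * (Q * Y * P) * Q = (P * Q) * Y * (P * Q) by simp only [Matrix.mul_assoc], hPQ,
      Matrix.one_mul, Matrix.mul_one]
  map_mul' X Y := by
    rw [show P * X * Q * (P * Y * Q) = P * X * (Q * P) * Y * Q by simp only [Matrix.mul_assoc], hQP,
      Matrix.mul_one, Matrix.mul_assoc P X Y]
  map_add' X Y := by rw [Matrix.mul_add, Matrix.add_mul]
  commutes' r := by
    rw [Algebra.algebraMap_eq_smul_one, Algebra.algebraMap_eq_smul_one, Matrix.mul_smul,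
      Matrix.smul_mul, Matrix.mul_one, hPQ]

section

variable {ι ι' : Type} [Fintype ι] [DecidableEq ι] [Fintype ι'] [DecidableEq ι']

/-- The primed matrices stand for transposes or for conjugate transposes, so that one computation
serves both kinds of form. -/
theorem preserves_congruent_iff {P : Matrix ι' ι ℂ} {Q : Matrix ι ι' ℂ} {P' : Matrix ι ι' ℂ}
    {Q' : Matrix ι' ι ℂ} (hPQ : P * Q = 1) (hQP : Q * P = 1) (hPQ' : P' * Q' = 1)
    (hQP' : Q' * P' = 1) (K : Matrix ι' ι' ℂ) (X X' : Matrix ι ι ℂ) :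
    X' * (P' * K * P) * X = P' * K * P ↔ Q' * (X' * P') * K * (P * X * Q) = K := by
  constructor <;> intro h
  · calc Q' * (X' * P') * K * (P * X * Q) = Q' * (X' * (P' * K * P) * X) * Q := by
          simp only [Matrix.mul_assoc]
      _ = Q' * P' * K * (P * Q) := by rw [h]; simp only [Matrix.mul_assoc]
      _ = K := by rw [hPQ, hQP', Matrix.one_mul, Matrix.mul_one]
  · calc X' * (P' * K * P) * X = P' * Q' * X' * (P' * K * P) * X * (Q * P) := by
          rw [hQP, hPQ', Matrix.one_mul, Matrix.mul_one]
      _ = P' * (Q' * (X' * P') * K * (P * X * Q)) * P := by simp only [Matrix.mul_assoc]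
      _ = P' * K * P := by rw [h]

theorem congrAlgEquiv_conjTranspose (P : Matrix ι' ι ℂ) (Q : Matrix ι ι' ℂ) (hPQ : P * Q = 1)
    (hQP : Q * P = 1) (K : Matrix ι' ι' ℂ) (X : Matrix ι ι ℂ) :
    Xᴴ * (Pᴴ * K * P) * X = Pᴴ * K * P ↔
      (congrAlgEquiv P Q hPQ hQP X)ᴴ * K * congrAlgEquiv P Q hPQ hQP X = K := by
  change _ ↔ (P * X * Q)ᴴ * K * (P * X * Q) = K
  rw [conjTranspose_mul, conjTranspose_mul]
  exact preserves_congruent_iff hPQ hQP (by rw [← conjTranspose_mul, hQP, conjTranspose_one])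
    (by rw [← conjTranspose_mul, hPQ, conjTranspose_one]) K X _

theorem congrAlgEquiv_transpose (P : Matrix ι' ι ℂ) (Q : Matrix ι ι' ℂ) (hPQ : P * Q = 1)
    (hQP : Q * P = 1) (K : Matrix ι' ι' ℂ) (X : Matrix ι ι ℂ) :
    Xᵀ * (Pᵀ * K * P) * X = Pᵀ * K * P ↔
      (congrAlgEquiv P Q hPQ hQP X)ᵀ * K * congrAlgEquiv P Q hPQ hQP X = K := by
  change _ ↔ (P * X * Q)ᵀ * K * (P * X * Q) = K
  rw [transpose_mul, transpose_mul]
  exact preserves_congruent_iff hPQ hQP (by rw [← transpose_mul, hQP, transpose_one])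
    (by rw [← transpose_mul, hPQ, transpose_one]) K X _

end

end CliffordGroups

/-! ### Anti-automorphisms as adjoints with respect to a form -/

namespace CliffordGroups

open Matrix CliffordAlgebra

section

variable {κ : Type} [Fintype κ] [DecidableEq κ] {w : κ → ℝ}

/-- A linear anti-endomorphism of the Clifford algebra that scales the generators by `σ`. -/
structure IsScaledReversion (w : κ → ℝ) (σ : ℝ)
    (τ : CliffordAlgebra (QuadraticMap.weightedSumSquares ℝ w) →ₗ[ℝ]
      CliffordAlgebra (QuadraticMap.weightedSumSquares ℝ w)) : Prop where
  map_one : τ 1 = 1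
  map_mul : ∀ x y, τ (x * y) = τ y * τ x
  map_gen : ∀ a, τ (gen w a) = σ • gen w a

theorem isScaledReversion_reverse (w : κ → ℝ) : IsScaledReversion w 1 reverse where
  map_one := reverse.map_one
  map_mul := reverse.map_mul
  map_gen a := by rw [gen, reverse_ι, one_smul]

theorem isScaledReversion_reverse_involute (w : κ → ℝ) :
    IsScaledReversion w (-1) (reverse ∘ₗ involute.toLinearMap) where
  map_one := by simp
  map_mul x y := by simp
  map_gen a := by simp [gen]

/-- The group cut out by `τ x * x = 1` is a given matrix group, up to an isomorphism of the
ambient algebras. -/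
def HasModel (τ : CliffordAlgebra (QuadraticMap.weightedSumSquares ℝ w) →ₗ[ℝ]
      CliffordAlgebra (QuadraticMap.weightedSumSquares ℝ w))
    {B : Type} [Ring B] [Algebra ℝ B] (H : Submonoid B) : Prop :=
  ∃ β : CliffordAlgebra (QuadraticMap.weightedSumSquares ℝ w) ≃ₐ[ℝ] B, ∀ x, τ x * x = 1 ↔ β x ∈ H

variable {τ : CliffordAlgebra (QuadraticMap.weightedSumSquares ℝ w) →ₗ[ℝ]
  CliffordAlgebra (QuadraticMap.weightedSumSquares ℝ w)} {σ : ℝ}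

/-- The relation `S β(τ x) = θ(β x) S` extends from generators to the algebra; multiply it by `β x`
and cancel the unit `S`. -/
theorem IsScaledReversion.mul_eq_one_iff (hτ : IsScaledReversion w σ τ) {A : Type*} [Ring A]
    [Algebra ℝ A] (β : CliffordAlgebra (QuadraticMap.weightedSumSquares ℝ w) ≃ₐ[ℝ] A)
    (θ : A →ₗ[ℝ] A) (hθ1 : θ 1 = 1) (hθ : ∀ x y, θ (x * y) = θ y * θ x) {S : A} (hS : IsUnit S)
    (h : ∀ a, σ • (S * β (gen w a)) = θ (β (gen w a)) * S) (x) :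
    τ x * x = 1 ↔ θ (β x) * S * β x = S := by
  have := intertwine_of_gen β.toAlgHom τ θ S hτ.map_one hτ.map_mul hθ1 hθ (fun a => by
    rw [hτ.map_gen, map_smul, mul_smul_comm]; exact h a) x
  have h2 : S * β (τ x) = θ (β x) * S := this
  rw [← h2, mul_assoc, ← _root_.map_mul, hS.mul_eq_left, map_eq_one_iff β β.injective]

variable {ι : Type} [Fintype ι] [DecidableEq ι] {Γ : GammaSystem κ ι}
  {β : CliffordAlgebra (QuadraticMap.weightedSumSquares ℝ w) ≃ₐ[ℝ] Matrix ι ι ℂ}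

/-- Conjugating the scalar `signRoot (w a)` produces the factor `w a` in `h`; the transpose leaves
the scalar alone, so in the analogous statement the signature drops out. -/
theorem IsScaledReversion.mul_eq_one_iff_conjTranspose (hτ : IsScaledReversion w σ τ)
    (hw : ∀ a, w a = 1 ∨ w a = -1)
    (hβ : ∀ a, β (gen w a) = Γ.twist w a) {S : Matrix ι ι ℂ} (hS : IsUnit S)
    (h : ∀ a, σ • (S * Γ.F a) = w a • (Γ.F a * S)) (x) :
    τ x * x = 1 ↔ (β x)ᴴ * S * β x = S := by
  let θ : Matrix ι ι ℂ →ₗ[ℝ] Matrix ι ι ℂ :=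
    { toFun := conjTranspose
      map_add' := conjTranspose_add
      map_smul' := fun r X => by simp [conjTranspose_smul] }
  refine hτ.mul_eq_one_iff β θ conjTranspose_one conjTranspose_mul hS (fun a => ?_) x
  change _ = (β (gen w a))ᴴ * S
  rw [hβ, Γ.conjTranspose_twist hw, GammaSystem.twist, mul_smul_comm, smul_comm, h,
    smul_mul_assoc, smul_mul_assoc, smul_comm]

theorem IsScaledReversion.mul_eq_one_iff_transpose (hτ : IsScaledReversion w σ τ)
    (hβ : ∀ a, β (gen w a) = Γ.twist w a) {S : Matrix ι ι ℂ} (hS : IsUnit S)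
    (h : ∀ a, σ • (S * Γ.F a) = (Γ.F a)ᵀ * S) (x) :
    τ x * x = 1 ↔ (β x)ᵀ * S * β x = S := by
  refine hτ.mul_eq_one_iff β (transposeLinearEquiv ι ι ℝ ℂ).toLinearMap transpose_one
    transpose_mul hS (fun a => ?_) x
  change _ = (β (gen w a))ᵀ * S
  rw [hβ, GammaSystem.twist, mul_smul_comm, smul_comm, h, transpose_smul, smul_mul_assoc]

variable {m : ℕ}

theorem exists_representation (hκ : Fintype.card κ = 2 * m + 1) (hw : ∀ a, w a = 1 ∨ w a = -1)
    (hprod : (-1 : ℝ) ^ (2 * m + 1).choose 2 * ∏ a, w a = -1) :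
    ∃ (ι : Type) (_ : Fintype ι) (_ : DecidableEq ι) (Γ : GammaSystem κ ι) (C : Matrix ι ι ℂ)
      (β : CliffordAlgebra (QuadraticMap.weightedSumSquares ℝ w) ≃ₐ[ℝ] Matrix ι ι ℂ),
      Fintype.card ι = 2 ^ m ∧ (∀ a, β (gen w a) = Γ.twist w a) ∧
      (∀ a, (-1 : ℝ) ^ m • (C * Γ.F a) = (Γ.F a)ᵀ * C) ∧ IsUnit C ∧
      (m % 4 = 0 ∨ m % 4 = 3 → Cᵀ = C) ∧ (m % 4 = 1 ∨ m % 4 = 2 → IsAltBlock C) := by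
  obtain ⟨κ', ι, _, _, _, _, Γ, C, hκ', hι, hC, hu, hs, ha⟩ := exists_gammaSystem m
  let e : κ ≃ κ' := Fintype.equivOfCardEq (hκ.trans hκ'.symm)
  obtain ⟨β, hβ⟩ := (Γ.reindex e).exists_algEquiv hw hκ hι hprod
  refine ⟨ι, _, _, Γ.reindex e, C, β, hι, hβ, fun a => ?_, hu, hs, ha⟩
  change (-1 : ℝ) ^ m • (C * Γ.F (e a)) = _
  rw [hC, smul_smul, ← mul_pow]
  simp [GammaSystem.reindex]

theorem hasModel_unitary (hκ : Fintype.card κ = 2 * m + 1) (hw : ∀ a, w a = 1 ∨ w a = -1)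
    (hprod : (-1 : ℝ) ^ (2 * m + 1).choose 2 * ∏ a, w a = -1) (hτ : IsScaledReversion w σ τ)
    (hσ : ∀ a, w a = σ) : HasModel τ (unitaryGrp (2 ^ m)) := by
  obtain ⟨ι, _, _, Γ, C, β, hι, hβ, -⟩ := exists_representation hκ hw hprod
  let e : ι ≃ Fin (2 ^ m) := Fintype.equivFinOfCardEq hι
  refine ⟨β.trans (reindexAlgEquiv ℝ ℂ e), fun x => ?_⟩
  rw [hτ.mul_eq_one_iff_conjTranspose hw hβ isUnit_one (fun a => by
    rw [hσ, Matrix.one_mul, Matrix.mul_one]), Matrix.mul_one, Matrix.mem_unitaryGroup_iff',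
    AlgEquiv.trans_apply, star_eq_conjTranspose, coe_reindexAlgEquiv, conjTranspose_reindex,
    ← coe_reindexAlgEquiv ℝ ℂ, ← map_mul,
    map_eq_one_iff _ (reindexAlgEquiv ℝ ℂ e).injective]

theorem hasModel_pseudoUnitary (hκ : Fintype.card κ = 2 * m + 1) (hw : ∀ a, w a = 1 ∨ w a = -1)
    (hprod : (-1 : ℝ) ^ (2 * m + 1).choose 2 * ∏ a, w a = -1) (hτ : IsScaledReversion w σ τ)
    (B : Finset κ) (hB : ∀ a, (a ∈ B → w a = -σ) ∧ (a ∉ B → w a = σ)) (heven : Even B.card)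
    (hne : B.Nonempty) {r : ℕ} (hr : 2 ^ m = r + r) : HasModel τ (pseudoUnitaryGrp r r) := by
  obtain ⟨ι, _, _, Γ, C, β, hι, hβ, -⟩ := exists_representation hκ hw hprod
  obtain ⟨S, hS, h1, h2, h3⟩ := exists_product (w := fun _ => 1) (E := Γ.F)
    (fun a => by rw [Γ.sq, map_one]) Γ.anti B
  have hSU : Sᴴ * S = 1 := by
    have : S ∈ (Matrix.unitaryGroup ι ℂ) := by
      refine Submonoid.closure_le.2 ?_ hS
      rintro _ ⟨a, rfl⟩
      rw [SetLike.mem_coe, mem_unitaryGroup_iff', star_eq_conjTranspose, Γ.herm, Γ.sq]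
    exact mem_unitaryGroup_iff'.1 this
  rw [Even.neg_one_pow heven] at h1
  rw [Even.add_one heven |>.neg_one_pow] at h2
  -- `S` squares to `±1`; the phase `1` or `i` makes it an involution. A unitary involution is
  -- Hermitian.
  obtain ⟨c, hc, hcS⟩ : ∃ c : ℂ, star c * c = 1 ∧ (c • S) * (c • S) = 1 := by
    rw [Finset.prod_const_one, mul_one] at h3
    rcases neg_one_pow_eq_or ℝ (B.card.choose 2) with h | h
    · exact ⟨1, by simp, by rw [smul_mul_smul_comm, h3, h]; simp⟩
    · exact ⟨Complex.I, by simp, by rw [smul_mul_smul_comm, h3, h]; simp⟩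
  have hH : (c • S)ᴴ = c • S := by
    have h : (c • S)ᴴ * (c • S) = 1 := by
      rw [conjTranspose_smul, smul_mul_smul_comm, hSU, hc, one_smul]
    exact left_inv_eq_right_inv h hcS
  obtain ⟨b, hb⟩ := hne
  -- As `B` has even size, `S` anticommutes with each of its own factors; any one of them forces the
  -- balanced signature.
  obtain ⟨P, Q, hPQ, hQP, hP⟩ := exists_congruent_balanced hH hcS (Γ.sq b)
    (by rw [smul_mul_assoc, h2 b hb, mul_smul_comm, neg_one_smul, smul_neg]) (hι.trans hr)
  refine ⟨β.trans (congrAlgEquiv P Q hPQ hQP), fun x => ?_⟩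
  rw [hτ.mul_eq_one_iff_conjTranspose hw hβ (IsUnit.of_mul_eq_one _ hcS) (fun a => ?_), ← hP,
    congrAlgEquiv_conjTranspose P Q hPQ hQP]
  · rfl
  · rw [smul_mul_assoc, mul_smul_comm]
    by_cases ha : a ∈ B
    · rw [h2 a ha, (hB a).1 ha]; simp
    · rw [h1 a ha, (hB a).2 ha]; simp

theorem hasModel_symplectic (hκ : Fintype.card κ = 2 * m + 1) (hw : ∀ a, w a = 1 ∨ w a = -1)
    (hprod : (-1 : ℝ) ^ (2 * m + 1).choose 2 * ∏ a, w a = -1)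
    (hτ : IsScaledReversion w ((-1) ^ m) τ) (hm : m % 4 = 1 ∨ m % 4 = 2) {r : ℕ}
    (hr : 2 ^ m = r + r) : HasModel τ (complexSymplecticGrp r) := by
  obtain ⟨ι, _, _, Γ, C, β, hι, hβ, hC, hu, -, ha⟩ := exists_representation hκ hw hprod
  obtain ⟨P, Q, hPQ, hQP, rfl⟩ := (ha hm).exists_congruent_J (hι.trans hr)
  refine ⟨β.trans (congrAlgEquiv P Q hPQ hQP), fun x => ?_⟩
  rw [hτ.mul_eq_one_iff_transpose hβ hu hC, congrAlgEquiv_transpose P Q hPQ hQP, SymplecticGroup.mem_iff']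
  rfl

theorem hasModel_orthogonal (hκ : Fintype.card κ = 2 * m + 1) (hw : ∀ a, w a = 1 ∨ w a = -1)
    (hprod : (-1 : ℝ) ^ (2 * m + 1).choose 2 * ∏ a, w a = -1)
    (hτ : IsScaledReversion w ((-1) ^ m) τ) (hm : m % 4 = 0 ∨ m % 4 = 3) :
    HasModel τ (complexOrthogonalGrp (2 ^ m)) := by
  obtain ⟨ι, _, _, Γ, C, β, hι, hβ, hC, hu, hs, -⟩ := exists_representation hκ hw hprod
  obtain ⟨P, Q, hPQ, hQP, hP⟩ := exists_transpose_mul_self (hs hm) hu hι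
  refine ⟨β.trans (congrAlgEquiv P Q hPQ hQP), fun x => ?_⟩
  have hP' : Pᵀ * (1 : Matrix (Fin (2 ^ m)) (Fin (2 ^ m)) ℂ) * P = C := by rw [Matrix.mul_one, hP]
  rw [hτ.mul_eq_one_iff_transpose hβ hu hC, ← hP', congrAlgEquiv_transpose P Q hPQ hQP, Matrix.mul_one,
    mem_orthogonalGroup_iff']
  rfl

end

end CliffordGroups

/-! ### Smoothness and the cases for the two anti-automorphisms -/

namespace CliffordGroups

open Matrix CliffordAlgebra

theorem isSmoothMap_of_linear {V W : Type*} [AddCommGroup V] [Module ℝ V] [AddCommGroup W]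
    [Module ℝ W] [Module.Finite ℝ V] [Module.Finite ℝ W] (S : Set V) (f : S → W) (L : V →ₗ[ℝ] W)
    (hL : ∀ x : S, f x = L x) : IsSmoothMap S f := by
  let a := (Module.finBasis ℝ V).equivFun
  let b := (Module.finBasis ℝ W).equivFun
  let F : (Fin (Module.finrank ℝ V) → ℝ) →ₗ[ℝ] (Fin (Module.finrank ℝ W) → ℝ) :=
    b.toLinearMap ∘ₗ L ∘ₗ a.symm.toLinearMap
  refine ⟨_, _, a, b, fun x => ⟨Set.univ, F, isOpen_univ, trivial, ?_, fun y _ => ?_⟩⟩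
  · exact (LinearMap.toContinuousLinearMap F).contDiff.contDiffOn
  · simp [F, hL]

/-- An injective algebra homomorphism that maps one group onto another is an isomorphism of
Lie groups. -/
theorem lieGroupIsomorphic_of_injective {A B : Type*} [Ring A] [Algebra ℝ A] [Ring B] [Algebra ℝ B]
    [Module.Finite ℝ A] [Module.Finite ℝ B] {G : Submonoid A} {H : Submonoid B} (Φ : B →ₐ[ℝ] A)
    (hΦ : Function.Injective Φ) (hH : ∀ y, y ∈ H ↔ Φ y ∈ G) (hG : ∀ x ∈ G, ∃ y, Φ y = x) :
    LieGroupIsomorphic G H := by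
  let f : H →* G := ((Φ : B →* A).comp H.subtype).codRestrict G fun y => (hH y).1 y.2
  have hf : Function.Bijective f := by
    refine ⟨fun x y h => Subtype.ext (hΦ (congrArg Subtype.val h)), fun x => ?_⟩
    obtain ⟨y, hy⟩ := hG x x.2
    exact ⟨⟨y, (hH y).2 (hy ▸ x.2)⟩, Subtype.ext hy⟩
  let φ : H ≃* G := MulEquiv.ofBijective f hf
  have hφ : ∀ y, ((φ y : G) : A) = Φ y := fun _ => rfl
  -- The map from `G` to `H` is the restriction of a linear left inverse of `Φ`, so it too is
  -- smooth.
  obtain ⟨L, hL⟩ := LinearMap.exists_leftInverse_of_injective Φ.toLinearMap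
    (LinearMap.ker_eq_bot.2 hΦ)
  refine ⟨φ.symm, isSmoothMap_of_linear _ _ L fun x => ?_,
    isSmoothMap_of_linear _ _ Φ.toLinearMap fun y => hφ y⟩
  obtain ⟨y, rfl⟩ := φ.surjective x
  rw [hφ, MulEquiv.symm_apply_apply]
  exact (LinearMap.congr_fun hL (y : B)).symm

section

variable {κ : Type} [Fintype κ] {w : κ → ℝ}
  {τ : CliffordAlgebra (QuadraticMap.weightedSumSquares ℝ w) →ₗ[ℝ]
    CliffordAlgebra (QuadraticMap.weightedSumSquares ℝ w)}

theorem HasModel.lieGroupIsomorphic {A B : Type} [Ring A] [Algebra ℝ A] [Ring B] [Algebra ℝ B]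
    [Module.Finite ℝ A] [Module.Finite ℝ B] {G : Submonoid A} {H : Submonoid B}
    (h : HasModel τ H) (Ψ : CliffordAlgebra (QuadraticMap.weightedSumSquares ℝ w) →ₐ[ℝ] A)
    (hΨ : Function.Injective Ψ) (hG : ∀ x, Ψ x ∈ G ↔ τ x * x = 1)
    (hsurj : ∀ y ∈ G, ∃ x, Ψ x = y) : LieGroupIsomorphic G H := by
  obtain ⟨β, hβ⟩ := h
  refine lieGroupIsomorphic_of_injective (Ψ.comp β.symm.toAlgHom)
    (hΨ.comp β.symm.injective) (fun y => ?_) fun x hx => ?_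
  · have := hβ (β.symm y)
    rw [β.apply_symm_apply] at this
    rw [← this, ← hG]
    rfl
  · obtain ⟨y, rfl⟩ := hsurj x hx
    refine ⟨β y, ?_⟩
    change Ψ (β.symm (β y)) = Ψ y
    rw [β.symm_apply_apply]

/-- The Clifford algebra is a matrix algebra over a field, hence simple. -/
theorem injective_of_representation [DecidableEq κ] {m : ℕ} (hκ : Fintype.card κ = 2 * m + 1)
    (hw : ∀ a, w a = 1 ∨ w a = -1)
    (hprod : (-1 : ℝ) ^ (2 * m + 1).choose 2 * ∏ a, w a = -1) {A : Type*} [Ring A] [Algebra ℝ A]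
    [Nontrivial A] (Ψ : CliffordAlgebra (QuadraticMap.weightedSumSquares ℝ w) →ₐ[ℝ] A) :
    Function.Injective Ψ := by
  obtain ⟨ι, _, _, Γ, C, β, hι, -⟩ := exists_representation hκ hw hprod
  have : Nonempty ι := Fintype.card_pos_iff.1 (by rw [hι]; positivity)
  have h : Function.Injective (Ψ.comp β.symm.toAlgHom) :=
    RingHom.injective (Ψ.comp β.symm.toAlgHom).toRingHom
  intro x y hxy
  apply β.injective
  apply h
  change Ψ (β.symm (β x)) = Ψ (β.symm (β y))
  rwa [β.symm_apply_apply, β.symm_apply_apply]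

end

/-- The weights of the form of signature `(p, q)`. -/
def signs (p q : ℕ) : Fin p ⊕ Fin q → ℝ := Sum.elim (fun _ => 1) (fun _ => -1)

theorem signs_eq (p q : ℕ) (a) : signs p q a = 1 ∨ signs p q a = -1 := by
  rcases a with a | a <;> simp [signs]

/-- The left side is the square of the product of all generators, and `C(2m+1, 2) = m(2m+1)` has the
parity of `m`. -/
theorem prod_signs {p q m : ℕ} (hodd : Odd (m + q)) :
    (-1 : ℝ) ^ (2 * m + 1).choose 2 * ∏ a, signs p q a = -1 := by
  have h1 : (2 * m + 1).choose 2 = m + 2 * (m * m) := by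
    rw [Nat.choose_two_right, Nat.add_sub_cancel, mul_comm 2 m, ← mul_assoc,
      Nat.mul_div_cancel _ two_pos]
    ring
  have h2 : ∏ a, signs p q a = (-1) ^ q := by simp [signs]
  rw [h1, h2, pow_add, pow_mul, neg_one_sq, one_pow, mul_one, ← pow_add, hodd.neg_one_pow]

theorem card_signs (p q : ℕ) : Fintype.card (Fin p ⊕ Fin q) = p + q := by simp

section

variable {p q m : ℕ} {A : Type} [Ring A] [Algebra ℝ A]
  [Module.Finite ℝ A] [Nontrivial A] {G : Submonoid A}
  (Ψ : CliffordAlgebra (QuadraticMap.weightedSumSquares ℝ (signs p q)) →ₐ[ℝ] A)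

/-- Here `σ = 1`, so the adjoint is a transpose for even `m` and Hermitian for odd `m`. In the
latter case the form is built from the `q` negative generators, and `q` is even. -/
theorem lieGroupIsomorphic_of_reverse (h : p + q = 2 * m + 1) (hodd : Odd (m + q))
    (hsurj : ∀ y ∈ G, ∃ x, Ψ x = y) (hG : ∀ x, Ψ x ∈ G ↔ reverse x * x = 1) :
    (q = 0 → LieGroupIsomorphic G (unitaryGrp (2 ^ m))) ∧
    (Odd m → q ≠ 0 → LieGroupIsomorphic G (pseudoUnitaryGrp (2 ^ (m - 1)) (2 ^ (m - 1)))) ∧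
    (m % 4 = 2 → LieGroupIsomorphic G (complexSymplecticGrp (2 ^ (m - 1)))) ∧
    (m % 4 = 0 → LieGroupIsomorphic G (complexOrthogonalGrp (2 ^ m))) := by
  have hκ := (card_signs p q).trans h
  have hprod := prod_signs (p := p) hodd
  have hinj := injective_of_representation hκ (signs_eq p q) hprod Ψ
  have hτ := isScaledReversion_reverse (signs p q)
  refine ⟨fun hq => ?_, fun hm hq => ?_, fun hm => ?_, fun hm => ?_⟩
  · refine (hasModel_unitary hκ (signs_eq p q) hprod hτ ?_).lieGroupIsomorphic Ψ hinj hG hsurj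
    subst hq
    rintro (a | a)
    · rfl
    · exact a.elim0
  · refine (hasModel_pseudoUnitary hκ (signs_eq p q) hprod hτ
      (Finset.univ.map Function.Embedding.inr) ?_ ?_ ?_ (r := 2 ^ (m - 1)) ?_).lieGroupIsomorphic
      Ψ hinj hG hsurj
    · rintro (a | a) <;> simp [signs]
    · rw [Finset.card_map, Finset.card_univ, Fintype.card_fin]
      exact (Nat.odd_add.1 hodd).1 hm
    · exact ⟨.inr ⟨0, Nat.pos_of_ne_zero hq⟩, by simp⟩
    · obtain ⟨k, rfl⟩ := hm
      rw [← two_mul, ← pow_succ', Nat.add_sub_cancel]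
  · have he : (-1 : ℝ) ^ m = 1 := Even.neg_one_pow (Nat.even_iff.2 (by omega))
    rw [← he] at hτ
    refine (hasModel_symplectic hκ (signs_eq p q) hprod hτ (.inr hm) (r := 2 ^ (m - 1))
      ?_).lieGroupIsomorphic Ψ hinj hG hsurj
    rw [← two_mul, ← pow_succ', Nat.sub_add_cancel (by omega)]
  · have he : (-1 : ℝ) ^ m = 1 := Even.neg_one_pow (Nat.even_iff.2 (by omega))
    rw [← he] at hτ
    exact (hasModel_orthogonal hκ (signs_eq p q) hprod hτ (.inl hm)).lieGroupIsomorphic Ψ hinj hG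
      hsurj

theorem lieGroupIsomorphic_of_reverse_involute (h : p + q = 2 * m + 1) (hodd : Odd (m + q))
    (hsurj : ∀ y ∈ G, ∃ x, Ψ x = y) (hG : ∀ x, Ψ x ∈ G ↔ reverse (involute x) * x = 1) :
    (p = 0 → LieGroupIsomorphic G (unitaryGrp (2 ^ m))) ∧
    (Even m → p ≠ 0 → LieGroupIsomorphic G (pseudoUnitaryGrp (2 ^ (m - 1)) (2 ^ (m - 1)))) ∧
    (m % 4 = 1 → LieGroupIsomorphic G (complexSymplecticGrp (2 ^ (m - 1)))) ∧
    (m % 4 = 3 → LieGroupIsomorphic G (complexOrthogonalGrp (2 ^ m))) := by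
  have hκ := (card_signs p q).trans h
  have hprod := prod_signs (p := p) hodd
  have hinj := injective_of_representation hκ (signs_eq p q) hprod Ψ
  have hτ := isScaledReversion_reverse_involute (signs p q)
  refine ⟨fun hp => ?_, fun hm hp => ?_, fun hm => ?_, fun hm => ?_⟩
  · refine (hasModel_unitary hκ (signs_eq p q) hprod hτ ?_).lieGroupIsomorphic Ψ hinj hG hsurj
    subst hp
    rintro (a | a)
    · exact a.elim0
    · rfl
  · have hp2 : Even p := by
      rw [Nat.even_iff] at hm ⊢
      rw [Nat.odd_iff] at hodd
      omega
    refine (hasModel_pseudoUnitary hκ (signs_eq p q) hprod hτ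
      (Finset.univ.map Function.Embedding.inl) ?_ ?_ ?_ (r := 2 ^ (m - 1)) ?_).lieGroupIsomorphic
      Ψ hinj hG hsurj
    · rintro (a | a) <;> simp [signs]
    · rwa [Finset.card_map, Finset.card_univ, Fintype.card_fin]
    · exact ⟨.inl ⟨0, Nat.pos_of_ne_zero hp⟩, by simp⟩
    -- `m = 0` would mean `p + q = 1`, which a nonzero even `p` excludes; so `2^m` can be halved.
    · have : m ≠ 0 := by
        rintro rfl
        obtain ⟨k, rfl⟩ := hp2
        omega
      rw [← two_mul, ← pow_succ', Nat.sub_add_cancel (by omega)]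
  · have he : (-1 : ℝ) ^ m = -1 := Odd.neg_one_pow (Nat.odd_iff.2 (by omega))
    rw [← he] at hτ
    refine (hasModel_symplectic hκ (signs_eq p q) hprod hτ (.inl hm) (r := 2 ^ (m - 1))
      ?_).lieGroupIsomorphic Ψ hinj hG hsurj
    rw [← two_mul, ← pow_succ', Nat.sub_add_cancel (by omega)]
  · have he : (-1 : ℝ) ^ m = -1 := Odd.neg_one_pow (Nat.odd_iff.2 (by omega))
    rw [← he] at hτ
    exact (hasModel_orthogonal hκ (signs_eq p q) hprod hτ (.inr hm)).lieGroupIsomorphic Ψ hinj hG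
      hsurj

end

end CliffordGroups

/-! ### Clifford algebra models of `Cl^{(0)} ⊕ i Cl^{(1)}` and of the even part -/

namespace CliffordGroups

open Matrix CliffordAlgebra

variable {p q : ℕ}

/-- The generators of `Cl_{p,q}`. -/
noncomputable def e (a : Fin p ⊕ Fin q) : Cl p q := gen (signs p q) a

theorem ι_form_eq_sum (v : Fin p ⊕ Fin q → ℝ) : ι (form p q) v = ∑ a, v a • e a :=
  ι_eq_sum_gen (signs p q) v

theorem e_sq (a : Fin p ⊕ Fin q) : e a * e a = algebraMap ℝ (Cl p q) (signs p q a) :=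
  gen_sq (signs p q) a

theorem e_anticomm {a b : Fin p ⊕ Fin q} (h : a ≠ b) : e a * e b = -(e b * e a) :=
  gen_anticomm (signs p q) h

theorem e_mem_odd (a : Fin p ⊕ Fin q) : e a ∈ evenOdd (form p q) 1 :=
  ι_mem_evenOdd_one (form p q) _

theorem reverse_e (a : Fin p ⊕ Fin q) : reverse (e a) = e a :=
  reverse_ι (Q := form p q) _

theorem involute_e (a : Fin p ⊕ Fin q) : involute (e a) = -e a :=
  involute_ι (Q := form p q) _

instance finite_cl : Module.Finite ℝ (Cl p q) := (finrank_cliffordAlgebra (signs p q)).1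

theorem algHom_induction {A : Type*} [Ring A] [Algebra ℝ A]
    (Ψ : CliffordAlgebra (QuadraticMap.weightedSumSquares ℝ (signs p q)) →ₐ[ℝ] A) (V : Submodule ℝ A)
    (h1 : 1 ∈ V) (hmul : ∀ x ∈ V, ∀ y ∈ V, x * y ∈ V) (hgen : ∀ a, Ψ (gen (signs p q) a) ∈ V) (x) :
    Ψ x ∈ V := by
  have hx : x ∈ Algebra.adjoin ℝ (Set.range (gen (signs p q))) := by
    rw [adjoin_range_gen]; trivial
  induction hx using Algebra.adjoin_induction with
  | mem x hx => obtain ⟨a, rfl⟩ := hx; exact hgen a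
  | algebraMap r =>
    rw [AlgHom.commutes, Algebra.algebraMap_eq_smul_one]
    exact V.smul_mem r h1
  | add x y _ _ hx hy => rw [map_add]; exact V.add_mem hx hy
  | mul x y _ _ hx hy => rw [map_mul]; exact hmul _ hx _ hy

/-- Even and odd elements are built up by two vectors at a time, and `(i v₁)(i v₂) = -v₁v₂` lies in
`R`. -/
theorem evenIOdd_le_range {R : Subalgebra ℝ (CCl p q)} (hR : ∀ a, Complex.I ⊗ₜ[ℝ] e a ∈ R)
    {U : CCl p q} (hU : U ∈ evenIOdd p q) : U ∈ R := by
  have hι : ∀ v, Complex.I ⊗ₜ[ℝ] ι (form p q) v ∈ R := by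
    intro v
    rw [ι_form_eq_sum, TensorProduct.tmul_sum]
    refine sum_mem fun a _ => ?_
    rw [TensorProduct.tmul_smul]
    exact R.smul_mem (hR a) _
  have hstep : ∀ (z : ℂ) (v₁ v₂) (x : Cl p q), z ⊗ₜ[ℝ] x ∈ R →
      z ⊗ₜ[ℝ] (ι (form p q) v₁ * ι (form p q) v₂ * x) ∈ R := by
    intro z v₁ v₂ x hx
    have := R.neg_mem (R.mul_mem (R.mul_mem (hι v₁) (hι v₂)) hx)
    rwa [Algebra.TensorProduct.tmul_mul_tmul, Algebra.TensorProduct.tmul_mul_tmul,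
      Complex.I_mul_I, neg_one_mul, TensorProduct.neg_tmul, neg_neg] at this
  obtain ⟨a, ha, b, hb, rfl⟩ := mem_evenIOdd.1 hU
  clear hU
  refine R.add_mem ?_ ?_
  · induction a, ha using even_induction with
    | algebraMap r =>
      rw [Algebra.algebraMap_eq_smul_one, TensorProduct.tmul_smul]
      exact R.smul_mem R.one_mem r
    | add x y _ _ hx hy => rw [TensorProduct.tmul_add]; exact R.add_mem hx hy
    | ι_mul_ι_mul v₁ v₂ x _ hx => exact hstep _ _ _ _ hx
  · induction b, hb using odd_induction with
    | ι v => exact hι v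
    | add x y _ _ hx hy => rw [TensorProduct.tmul_add]; exact R.add_mem hx hy
    | ι_mul_ι_mul v₁ v₂ x _ hx => exact hstep _ _ _ _ hx

theorem pseudoHerm_tmul (z : ℂ) (x : Cl p q) :
    pseudoHerm (z ⊗ₜ[ℝ] x) = (starRingEnd ℂ z) ⊗ₜ[ℝ] reverse x := rfl

theorem gradeInv_tmul (z : ℂ) (x : Cl p q) :
    gradeInv (z ⊗ₜ[ℝ] x) = z ⊗ₜ[ℝ] involute x := rfl

/-- `Cl_{q,p}` is isomorphic to `Cl^{(0)}_{p,q} ⊕ i Cl^{(1)}_{p,q}`. -/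
theorem exists_evenIOdd_model (p q : ℕ) :
    ∃ Ψ : CliffordAlgebra (QuadraticMap.weightedSumSquares ℝ (signs q p)) →ₐ[ℝ] CCl p q,
      (∀ U, U ∈ evenIOdd p q ↔ ∃ x, Ψ x = U) ∧
      (∀ x, pseudoHerm (Ψ x) = Ψ (reverse (involute x))) ∧
      (∀ x, pseudoHerm (gradeInv (Ψ x)) = Ψ (reverse x)) := by
  obtain ⟨Ψ, hΨ⟩ := exists_algHom_gen (w := signs q p)
    (E := fun a => Complex.I ⊗ₜ[ℝ] (e a.swap : Cl p q)) (fun a => by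
      rw [Algebra.TensorProduct.tmul_mul_tmul, Complex.I_mul_I, e_sq,
        Algebra.TensorProduct.algebraMap_apply, Algebra.algebraMap_eq_smul_one (signs p q _),
        TensorProduct.tmul_smul, TensorProduct.smul_tmul']
      congr 1
      rcases a with a | a <;> simp [signs]) (fun a b hab => by
      rw [Algebra.TensorProduct.tmul_mul_tmul, Algebra.TensorProduct.tmul_mul_tmul,
        e_anticomm (Sum.swap_leftInverse.injective.ne hab), TensorProduct.tmul_neg])
  have hmem : ∀ x, Ψ x ∈ evenIOdd p q := by
    refine algHom_induction Ψ _ evenIOdd_one (fun x hx y hy => evenIOdd_mul hx hy) fun a => ?_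
    rw [hΨ]
    exact mem_evenIOdd.2 ⟨0, zero_mem _, _, e_mem_odd a.swap, by simp⟩
  refine ⟨Ψ, fun U => ⟨fun hU => ?_, ?_⟩, fun x => ?_, fun x => ?_⟩
  · refine evenIOdd_le_range (R := Ψ.range) (fun a => ⟨gen (signs q p) a.swap, ?_⟩) hU
    exact (hΨ _).trans (by rw [Sum.swap_swap])
  · rintro ⟨x, rfl⟩
    exact hmem x
  · have hτ := isScaledReversion_reverse_involute (signs q p)
    -- Conjugation negates `i` and reversion fixes `e a`, so `i e a` changes sign; the grade
    -- involution would restore it.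
    have := intertwine_of_gen Ψ _ pseudoHerm 1 hτ.map_one hτ.map_mul pseudoHerm_one
      pseudoHerm_mul (fun a => by
        rw [hτ.map_gen, map_smul, hΨ, pseudoHerm_tmul, reverse_e]
        simp [TensorProduct.neg_tmul]) x
    rw [one_mul, mul_one] at this
    exact this.symm
  · have hτ := isScaledReversion_reverse (signs q p)
    have := intertwine_of_gen Ψ _ (pseudoHerm ∘ₗ gradeInv.toLinearMap) 1 hτ.map_one hτ.map_mul
      (by simp [pseudoHerm_one]) (by simp [pseudoHerm_mul]) (fun a => by
        rw [hτ.map_gen, map_smul, hΨ, LinearMap.comp_apply, AlgHom.toLinearMap_apply,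
          gradeInv_tmul, involute_e, pseudoHerm_tmul, map_neg, reverse_e]
        simp [TensorProduct.neg_tmul, TensorProduct.tmul_neg]) x
    rw [one_mul, mul_one] at this
    exact this.symm

theorem even_le_range {R : Subalgebra ℝ (Cl p q)} (hR : ∀ a b, e a * e b ∈ R) {U : Cl p q}
    (hU : U ∈ evenOdd (form p q) 0) : U ∈ R := by
  induction U, hU using even_induction with
  | algebraMap r => exact R.algebraMap_mem r
  | add x y _ _ hx hy => exact R.add_mem hx hy
  | ι_mul_ι_mul v₁ v₂ x _ hx =>
    refine R.mul_mem ?_ hx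
    rw [ι_form_eq_sum, ι_form_eq_sum, Finset.sum_mul_sum]
    refine sum_mem fun a _ => sum_mem fun b _ => ?_
    rw [smul_mul_smul_comm]
    exact R.smul_mem (hR a b) _

/-- The even part of `Cl_{p,q}` is a Clifford algebra on one generator less. -/
theorem exists_even_model {p' q' : ℕ} (c : Fin p ⊕ Fin q) (f : Fin p' ⊕ Fin q' → Fin p ⊕ Fin q)
    (hf : Function.Injective f) (hc : ∀ b, b ≠ c ↔ ∃ a, f a = b)
    (hs : ∀ a, signs p' q' a = -(signs p q c * signs p q (f a))) :
    ∃ Ψ : CliffordAlgebra (QuadraticMap.weightedSumSquares ℝ (signs p' q')) →ₐ[ℝ] Cl p q,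
      (∀ U, U ∈ evenOdd (form p q) 0 ↔ ∃ x, Ψ x = U) ∧
      (∀ x, reverse (Ψ x) = Ψ (reverse (involute x))) := by
  have hfc : ∀ a, f a ≠ c := fun a => (hc _).2 ⟨a, rfl⟩
  -- This one identity gives the squares and the anticommutation of the `e c * e a`, and it recovers
  -- every `e a * e b` from them.
  have hswap : ∀ a b : Fin p ⊕ Fin q, a ≠ c →
      e c * e a * (e c * e b) = -(signs p q c • (e a * e b)) := by
    intro a b ha
    rw [mul_assoc, ← mul_assoc (e a), e_anticomm ha, neg_mul, mul_neg, mul_assoc (e c) (e a),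
      ← mul_assoc (e c) (e c), e_sq, ← Algebra.smul_def]
  obtain ⟨Ψ, hΨ⟩ := exists_algHom_gen (w := signs p' q') (E := fun a => (e c * e (f a) : Cl p q))
    (fun a => by
      rw [hswap _ _ (hfc a), e_sq, hs, map_neg, map_mul, Algebra.smul_def]) (fun a b hab => by
      rw [hswap _ _ (hfc a), hswap _ _ (hfc b), e_anticomm (hf.ne hab), smul_neg])
  have hmem : ∀ x, Ψ x ∈ evenOdd (form p q) 0 := by
    refine algHom_induction Ψ _ one_mem_even
      (fun x hx y hy => evenOdd_mul (by decide) hx hy) fun a => ?_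
    rw [hΨ]
    exact evenOdd_mul (by decide) (e_mem_odd c) (e_mem_odd _)
  have hr : ∀ b, b ≠ c → e c * e b ∈ Ψ.range := by
    intro b hb
    obtain ⟨a, rfl⟩ := (hc b).1 hb
    exact ⟨_, hΨ a⟩
  have hne : signs p q c ≠ 0 := by rcases signs_eq p q c with h | h <;> rw [h] <;> norm_num
  refine ⟨Ψ, fun U => ⟨fun hU => ?_, ?_⟩, fun x => ?_⟩
  · refine even_le_range (R := Ψ.range) (fun a b => ?_) hU
    by_cases ha : a = c
    · subst ha
      by_cases hb : b = a
      · subst hb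
        rw [e_sq]
        exact Ψ.range.algebraMap_mem _
      · exact hr b hb
    · by_cases hb : b = c
      · subst hb
        rw [e_anticomm ha]
        exact neg_mem (hr a ha)
      · have := Ψ.range.smul_mem (neg_mem (mul_mem (hr a ha) (hr b hb))) (signs p q c)⁻¹
        rwa [hswap a b ha, neg_neg, smul_smul, inv_mul_cancel₀ hne, one_smul] at this
  · rintro ⟨x, rfl⟩
    exact hmem x
  · have hτ := isScaledReversion_reverse_involute (signs p' q')
    have := intertwine_of_gen Ψ _ reverse 1 hτ.map_one hτ.map_mul reverse.map_one
      reverse.map_mul (fun a => by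
        rw [hτ.map_gen, map_smul, hΨ, reverse.map_mul, reverse_e, reverse_e,
          e_anticomm (hfc a)]
        simp) x
    rw [one_mul, mul_one] at this
    exact this.symm

end CliffordGroups

/-! ### The five families of groups -/

namespace CliffordGroups

open Matrix CliffordAlgebra

variable {p q m : ℕ}

theorem lieGroupIsomorphic_G23 (h : p + q = 2 * m + 1) (hodd : Odd (m + q)) :
    (q = 0 → LieGroupIsomorphic (G23 p q) (unitaryGrp (2 ^ m))) ∧
    (Odd m → q ≠ 0 →
      LieGroupIsomorphic (G23 p q) (pseudoUnitaryGrp (2 ^ (m - 1)) (2 ^ (m - 1)))) ∧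
    (m % 4 = 2 → LieGroupIsomorphic (G23 p q) (complexSymplecticGrp (2 ^ (m - 1)))) ∧
    (m % 4 = 0 → LieGroupIsomorphic (G23 p q) (complexOrthogonalGrp (2 ^ m))) :=
  lieGroupIsomorphic_of_reverse (G := G23 p q) (AlgHom.id ℝ (Cl p q)) h hodd
    (fun y _ => ⟨y, rfl⟩) (fun _ => Iff.rfl)

theorem lieGroupIsomorphic_G12 (h : p + q = 2 * m + 1) (hodd : Odd (m + q)) :
    (p = 0 → LieGroupIsomorphic (G12 p q) (unitaryGrp (2 ^ m))) ∧
    (Even m → p ≠ 0 →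
      LieGroupIsomorphic (G12 p q) (pseudoUnitaryGrp (2 ^ (m - 1)) (2 ^ (m - 1)))) ∧
    (m % 4 = 1 → LieGroupIsomorphic (G12 p q) (complexSymplecticGrp (2 ^ (m - 1)))) ∧
    (m % 4 = 3 → LieGroupIsomorphic (G12 p q) (complexOrthogonalGrp (2 ^ m))) :=
  lieGroupIsomorphic_of_reverse_involute (G := G12 p q) (AlgHom.id ℝ (Cl p q)) h hodd
    (fun y _ => ⟨y, rfl⟩) (fun _ => Iff.rfl)

theorem lieGroupIsomorphic_G2i1 (h : p + q = 2 * m + 1) (hodd : Odd (m + p)) :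
    (q = 0 → LieGroupIsomorphic (G2i1 p q) (unitaryGrp (2 ^ m))) ∧
    (Even m → q ≠ 0 →
      LieGroupIsomorphic (G2i1 p q) (pseudoUnitaryGrp (2 ^ (m - 1)) (2 ^ (m - 1)))) ∧
    (m % 4 = 1 → LieGroupIsomorphic (G2i1 p q) (complexSymplecticGrp (2 ^ (m - 1)))) ∧
    (m % 4 = 3 → LieGroupIsomorphic (G2i1 p q) (complexOrthogonalGrp (2 ^ m))) := by
  obtain ⟨Ψ, h1, h2, -⟩ := exists_evenIOdd_model p q
  have h' : q + p = 2 * m + 1 := by omega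
  have hinj := injective_of_representation ((card_signs q p).trans h') (signs_eq q p)
    (prod_signs (p := q) hodd) Ψ
  refine lieGroupIsomorphic_of_reverse_involute Ψ h' hodd (fun y hy => (h1 y).1 hy.1) fun x => ?_
  change Ψ x ∈ evenIOdd p q ∧ pseudoHerm (Ψ x) * Ψ x = 1 ↔ _
  rw [and_iff_right ((h1 _).2 ⟨x, rfl⟩), h2, ← map_mul, map_eq_one_iff Ψ hinj]

theorem lieGroupIsomorphic_G2i3 (h : p + q = 2 * m + 1) (hodd : Odd (m + p)) :
    (p = 0 → LieGroupIsomorphic (G2i3 p q) (unitaryGrp (2 ^ m))) ∧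
    (Odd m → p ≠ 0 →
      LieGroupIsomorphic (G2i3 p q) (pseudoUnitaryGrp (2 ^ (m - 1)) (2 ^ (m - 1)))) ∧
    (m % 4 = 2 → LieGroupIsomorphic (G2i3 p q) (complexSymplecticGrp (2 ^ (m - 1)))) ∧
    (m % 4 = 0 → LieGroupIsomorphic (G2i3 p q) (complexOrthogonalGrp (2 ^ m))) := by
  obtain ⟨Ψ, h1, -, h2⟩ := exists_evenIOdd_model p q
  have h' : q + p = 2 * m + 1 := by omega
  have hinj := injective_of_representation ((card_signs q p).trans h') (signs_eq q p)
    (prod_signs (p := q) hodd) Ψ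
  refine lieGroupIsomorphic_of_reverse Ψ h' hodd (fun y hy => (h1 y).1 hy.1) fun x => ?_
  change Ψ x ∈ evenIOdd p q ∧ pseudoHerm (gradeInv (Ψ x)) * Ψ x = 1 ↔ _
  rw [and_iff_right ((h1 _).2 ⟨x, rfl⟩), h2, ← map_mul, map_eq_one_iff Ψ hinj]

theorem lieGroupIsomorphic_G2_of_model {p' q' : ℕ} (h : p' + q' = 2 * m + 1) (hodd : Odd (m + q'))
    (c : Fin p ⊕ Fin q) (f : Fin p' ⊕ Fin q' → Fin p ⊕ Fin q)
    (hf : Function.Injective f) (hc : ∀ b, b ≠ c ↔ ∃ a, f a = b)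
    (hs : ∀ a, signs p' q' a = -(signs p q c * signs p q (f a))) :
    (p' = 0 → LieGroupIsomorphic (G2 p q) (unitaryGrp (2 ^ m))) ∧
    (Even m → p' ≠ 0 →
      LieGroupIsomorphic (G2 p q) (pseudoUnitaryGrp (2 ^ (m - 1)) (2 ^ (m - 1)))) ∧
    (m % 4 = 1 → LieGroupIsomorphic (G2 p q) (complexSymplecticGrp (2 ^ (m - 1)))) ∧
    (m % 4 = 3 → LieGroupIsomorphic (G2 p q) (complexOrthogonalGrp (2 ^ m))) := by
  obtain ⟨Ψ, h1, h2⟩ := exists_even_model c f hf hc hs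
  have hinj := injective_of_representation ((card_signs p' q').trans h) (signs_eq p' q')
    (prod_signs (p := p') hodd) Ψ
  refine lieGroupIsomorphic_of_reverse_involute Ψ h hodd (fun y hy => (h1 y).1 hy.1) fun x => ?_
  change Ψ x ∈ evenOdd (form p q) 0 ∧ reverse (Ψ x) * Ψ x = 1 ↔ _
  rw [and_iff_right ((h1 _).2 ⟨x, rfl⟩), h2, ← map_mul, map_eq_one_iff Ψ hinj]

/-- The omitted generator has square `-1`, so multiplication by it preserves the remaining signs:
the even part is a `Cl_{p,q}`. -/
theorem lieGroupIsomorphic_G2_succ_right (h : p + q = 2 * m + 1) (hodd : Odd (m + q)) :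
    (p = 0 → LieGroupIsomorphic (G2 p (q + 1)) (unitaryGrp (2 ^ m))) ∧
    (Even m → p ≠ 0 →
      LieGroupIsomorphic (G2 p (q + 1)) (pseudoUnitaryGrp (2 ^ (m - 1)) (2 ^ (m - 1)))) ∧
    (m % 4 = 1 → LieGroupIsomorphic (G2 p (q + 1)) (complexSymplecticGrp (2 ^ (m - 1)))) ∧
    (m % 4 = 3 → LieGroupIsomorphic (G2 p (q + 1)) (complexOrthogonalGrp (2 ^ m))) := by
  refine lieGroupIsomorphic_G2_of_model h hodd (.inr 0) (Sum.map id Fin.succ)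
    (Function.injective_id.sumMap (Fin.succ_injective q)) ?_ ?_
  · rintro (b | b)
    · simp
    · simp [Fin.exists_succ_eq]
  · rintro (a | a) <;> simp [signs]

/-- The omitted generator has square `1`, which reverses the remaining signs: the even part is a
`Cl_{q,p}`. -/
theorem lieGroupIsomorphic_G2_succ_left (h : p + q = 2 * m + 1) (hodd : Odd (m + p)) :
    (q = 0 → LieGroupIsomorphic (G2 (p + 1) q) (unitaryGrp (2 ^ m))) ∧
    (Even m → q ≠ 0 →
      LieGroupIsomorphic (G2 (p + 1) q) (pseudoUnitaryGrp (2 ^ (m - 1)) (2 ^ (m - 1)))) ∧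
    (m % 4 = 1 → LieGroupIsomorphic (G2 (p + 1) q) (complexSymplecticGrp (2 ^ (m - 1)))) ∧
    (m % 4 = 3 → LieGroupIsomorphic (G2 (p + 1) q) (complexOrthogonalGrp (2 ^ m))) := by
  refine lieGroupIsomorphic_G2_of_model (by omega : q + p = 2 * m + 1) hodd (.inl 0)
    (Sum.elim .inr (.inl ∘ Fin.succ)) ?_ ?_ ?_
  · rintro (a | a) (b | b) hab <;> simp_all
  · rintro (b | b)
    · simp [Fin.exists_succ_eq]
    · simp
  · rintro (a | a) <;> simp [signs]

end CliffordGroups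

theorem theorem2 (p q n : ℕ) (hn : n = p + q) :
    (((p : ℤ) - q ≡ 3 [ZMOD 8] ∨ (p : ℤ) - q ≡ 7 [ZMOD 8]) →
      (((p, q) = (n, 0)) →
        LieGroupIsomorphic (G23 p q) (unitaryGrp (2 ^ ((n - 1) / 2)))) ∧
      ((n ≡ 3 [MOD 8] ∨ n ≡ 7 [MOD 8]) ∧ q ≠ 0 →
        LieGroupIsomorphic (G23 p q)
          (pseudoUnitaryGrp (2 ^ ((n - 3) / 2)) (2 ^ ((n - 3) / 2)))) ∧
      (n ≡ 5 [MOD 8] →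
        LieGroupIsomorphic (G23 p q) (complexSymplecticGrp (2 ^ ((n - 3) / 2)))) ∧
      (n ≡ 1 [MOD 8] →
        LieGroupIsomorphic (G23 p q) (complexOrthogonalGrp (2 ^ ((n - 1) / 2))))) ∧
    (((p : ℤ) - q ≡ 3 [ZMOD 8] ∨ (p : ℤ) - q ≡ 7 [ZMOD 8]) →
      (((p, q) = (0, n)) →
        LieGroupIsomorphic (G12 p q) (unitaryGrp (2 ^ ((n - 1) / 2)))) ∧
      ((n ≡ 1 [MOD 8] ∨ n ≡ 5 [MOD 8]) ∧ p ≠ 0 →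
        LieGroupIsomorphic (G12 p q)
          (pseudoUnitaryGrp (2 ^ ((n - 3) / 2)) (2 ^ ((n - 3) / 2)))) ∧
      (n ≡ 3 [MOD 8] →
        LieGroupIsomorphic (G12 p q) (complexSymplecticGrp (2 ^ ((n - 3) / 2)))) ∧
      (n ≡ 7 [MOD 8] →
        LieGroupIsomorphic (G12 p q) (complexOrthogonalGrp (2 ^ ((n - 1) / 2))))) ∧
    (((p : ℤ) - q ≡ 1 [ZMOD 8] ∨ (p : ℤ) - q ≡ 5 [ZMOD 8]) →
      (((p, q) = (n, 0)) →
        LieGroupIsomorphic (G2i1 p q) (unitaryGrp (2 ^ ((n - 1) / 2)))) ∧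
      ((n ≡ 1 [MOD 8] ∨ n ≡ 5 [MOD 8]) ∧ q ≠ 0 →
        LieGroupIsomorphic (G2i1 p q)
          (pseudoUnitaryGrp (2 ^ ((n - 3) / 2)) (2 ^ ((n - 3) / 2)))) ∧
      (n ≡ 3 [MOD 8] →
        LieGroupIsomorphic (G2i1 p q) (complexSymplecticGrp (2 ^ ((n - 3) / 2)))) ∧
      (n ≡ 7 [MOD 8] →
        LieGroupIsomorphic (G2i1 p q) (complexOrthogonalGrp (2 ^ ((n - 1) / 2))))) ∧
    (((p : ℤ) - q ≡ 1 [ZMOD 8] ∨ (p : ℤ) - q ≡ 5 [ZMOD 8]) →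
      (((p, q) = (0, n)) →
        LieGroupIsomorphic (G2i3 p q) (unitaryGrp (2 ^ ((n - 1) / 2)))) ∧
      ((n ≡ 3 [MOD 8] ∨ n ≡ 7 [MOD 8]) ∧ p ≠ 0 →
        LieGroupIsomorphic (G2i3 p q)
          (pseudoUnitaryGrp (2 ^ ((n - 3) / 2)) (2 ^ ((n - 3) / 2)))) ∧
      (n ≡ 5 [MOD 8] →
        LieGroupIsomorphic (G2i3 p q) (complexSymplecticGrp (2 ^ ((n - 3) / 2)))) ∧
      (n ≡ 1 [MOD 8] →
        LieGroupIsomorphic (G2i3 p q) (complexOrthogonalGrp (2 ^ ((n - 1) / 2))))) ∧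
    (((p : ℤ) - q ≡ 2 [ZMOD 8] ∨ (p : ℤ) - q ≡ 6 [ZMOD 8]) →
      (((p, q) = (n, 0) ∨ (p, q) = (0, n)) →
        LieGroupIsomorphic (G2 p q) (unitaryGrp (2 ^ ((n - 2) / 2)))) ∧
      ((n ≡ 2 [MOD 8] ∨ n ≡ 6 [MOD 8]) ∧ p ≠ 0 ∧ q ≠ 0 →
        LieGroupIsomorphic (G2 p q)
          (pseudoUnitaryGrp (2 ^ ((n - 4) / 2)) (2 ^ ((n - 4) / 2)))) ∧
      (n ≡ 4 [MOD 8] →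
        LieGroupIsomorphic (G2 p q) (complexSymplecticGrp (2 ^ ((n - 4) / 2)))) ∧
      (n ≡ 0 [MOD 8] →
        LieGroupIsomorphic (G2 p q) (complexOrthogonalGrp (2 ^ ((n - 2) / 2))))) := by

  simp only [Int.ModEq, Nat.ModEq, Prod.mk.injEq]
  refine ⟨fun hpq => ?_, fun hpq => ?_, fun hpq => ?_, fun hpq => ?_, fun hpq => ?_⟩
  · obtain ⟨m, rfl⟩ : ∃ m, n = 2 * m + 1 := ⟨n / 2, by omega⟩
    obtain ⟨h1, h2, h3, h4⟩ := lieGroupIsomorphic_G23 (p := p) (q := q) (m := m) (by omega)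
      (Nat.odd_iff.2 (by omega))
    rw [show (2 * m + 1 - 1) / 2 = m by omega, show (2 * m + 1 - 3) / 2 = m - 1 by omega]
    exact ⟨fun h => h1 (by omega), fun h => h2 (Nat.odd_iff.2 (by omega)) h.2,
      fun h => h3 (by omega), fun h => h4 (by omega)⟩
  · obtain ⟨m, rfl⟩ : ∃ m, n = 2 * m + 1 := ⟨n / 2, by omega⟩
    obtain ⟨h1, h2, h3, h4⟩ := lieGroupIsomorphic_G12 (p := p) (q := q) (m := m) (by omega)
      (Nat.odd_iff.2 (by omega))
    rw [show (2 * m + 1 - 1) / 2 = m by omega, show (2 * m + 1 - 3) / 2 = m - 1 by omega]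
    exact ⟨fun h => h1 (by omega), fun h => h2 (Nat.even_iff.2 (by omega)) h.2,
      fun h => h3 (by omega), fun h => h4 (by omega)⟩
  · obtain ⟨m, rfl⟩ : ∃ m, n = 2 * m + 1 := ⟨n / 2, by omega⟩
    obtain ⟨h1, h2, h3, h4⟩ := lieGroupIsomorphic_G2i1 (p := p) (q := q) (m := m) (by omega)
      (Nat.odd_iff.2 (by omega))
    rw [show (2 * m + 1 - 1) / 2 = m by omega, show (2 * m + 1 - 3) / 2 = m - 1 by omega]
    exact ⟨fun h => h1 (by omega), fun h => h2 (Nat.even_iff.2 (by omega)) h.2,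
      fun h => h3 (by omega), fun h => h4 (by omega)⟩
  · obtain ⟨m, rfl⟩ : ∃ m, n = 2 * m + 1 := ⟨n / 2, by omega⟩
    obtain ⟨h1, h2, h3, h4⟩ := lieGroupIsomorphic_G2i3 (p := p) (q := q) (m := m) (by omega)
      (Nat.odd_iff.2 (by omega))
    rw [show (2 * m + 1 - 1) / 2 = m by omega, show (2 * m + 1 - 3) / 2 = m - 1 by omega]
    exact ⟨fun h => h1 (by omega), fun h => h2 (Nat.odd_iff.2 (by omega)) h.2,
      fun h => h3 (by omega), fun h => h4 (by omega)⟩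
  · obtain ⟨m, rfl⟩ : ∃ m, n = 2 * m + 2 := ⟨n / 2 - 1, by omega⟩
    rw [show (2 * m + 2 - 2) / 2 = m by omega, show (2 * m + 2 - 4) / 2 = m - 1 by omega]
    -- A negative generator is split off whenever there is one; only the definite case `q = 0` needs
    -- a positive one.
    rcases q with _ | q
    · obtain ⟨p, rfl⟩ : ∃ k, p = k + 1 := ⟨p - 1, by omega⟩
      obtain ⟨h1, -, h3, h4⟩ := lieGroupIsomorphic_G2_succ_left (p := p) (q := 0) (m := m)
        (by omega) (Nat.odd_iff.2 (by omega))
      exact ⟨fun _ => h1 rfl, fun h => absurd rfl h.2.2, fun h => h3 (by omega),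
        fun h => h4 (by omega)⟩
    · obtain ⟨h1, h2, h3, h4⟩ := lieGroupIsomorphic_G2_succ_right (p := p) (q := q) (m := m)
        (by omega) (Nat.odd_iff.2 (by omega))
      exact ⟨fun h => h1 (by omega), fun h => h2 (Nat.even_iff.2 (by omega)) h.2.1,
        fun h => h3 (by omega), fun h => h4 (by omega)⟩
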